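/- Let $\gamma$ be a simple piecewise $C^1$ loop in $\mathbb{C}$ that starts at and returns to the origin (as a simple closed curve it encircles the point at infinity once; its direction is immaterial). Let $W$ be an $N\times N$ weight of Bessel type on $\gamma$: on $\gamma\setminus\{0\}$ each entry is a finite sum of terms $\varphi(z)\,z^{p}\log^{q}(z)\,e^{-\lambda/z}$ with $p\in\mathbb{C}$, $q\in\mathbb{N}$, $\operatorname{Re}\lambda\ge 0$, $\varphi$ entire and nonvanishing on $\gamma$ (for a continuous branch of the logarithm along $\gamma\setminus\{0\}$), and the entries of $W$ are integrable along $\gamma$. Let $W_n=\int_\gamma z^nW(z)\frac{dz}{2\pi i}$ and assume that $W$ is regular, $\det[W_{j+k}]_{j,k=0}^n\neq0$ for all $n\ge 0$, and semiclassical with trivial right factor: $$z^2W'(z)=(h_0+h_1z+h_2z^2)\,W(z),\qquad z\in\gamma\setminus\{0\},$$ with constant matrices $h_0,h_1,h_2\in\mathbb{C}^{N\times N}$. Let $P_n$ be the monic left orthogonal polynomials, with nonsingular $C_n$: $\int_\gamma P_n(z)W(z)z^k\frac{dz}{2\pi i}=\delta_{n,k}C_n^{-1}$ for $0\le k\le n$.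 Then there are unique matrices $\xi_n,\eta_n$ ($n\ge 0$) with $\eta_0=0$, $zP_0=P_1+\xi_0P_0$ and $zP_n=P_{n+1}+\xi_nP_n+\eta_nP_{n-1}$ for $n\ge1$. They satisfy $\eta_n=C_n^{-1}C_{n-1}$ for $n\ge1$ and, for all $n\ge0$, with $S_n=\sum_{k=0}^{n-1}\xi_k$ (empty sums are $0$; the terms with index $n-1$ are absent for $n=0$) and $[A,B]=AB-BA$, $$(2n+1)\xi_n+h_0+h_2(\eta_{n+1}+\eta_n)+(h_2\xi_n+h_1)\xi_n+S_n+C_n^{-1}\Big(\sum_{k=0}^{n}C_k\xi_kC_k^{-1}\Big)C_n=[S_n,h_2]S_{n+1}-\Big[\sum_{0\le j<i\le n-1}\xi_i\xi_j-\sum_{k=0}^{n-1}\eta_k,\;h_2\Big]+[S_n,h_1],$$ $$\xi_n^2-\eta_n\big((2n-1)I+h_1+h_2(\xi_n+\xi_{n-1})\big)+\big((2n+3)I+h_1+h_2(\xi_n+\xi_{n+1})\big)\eta_{n+1}=[S_n,h_2]\eta_{n+1}-\eta_n[S_{n-1},h_2]-\Big[\xi_n,\;C_n^{-1}\Big(\sum_{k=0}^{n-1}C_k\xi_kC_k^{-1}\Big)C_n\Big].$$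 If moreover $h_0,h_1,h_2$ commute pairwise, then all the matrices $h_0,h_1,h_2,\xi_n,\eta_n$ commute with each other and the system reduces to a discrete Painlevé IV equation: for all $n\ge0$, $$\big(h_2\xi_n+h_1+(2n+1)I\big)\xi_n+h_0+h_2(\eta_{n+1}+\eta_n)+S_n+S_{n+1}=0,$$ $$\xi_n^2+\big(h_2(\xi_n+\xi_{n+1})+h_1+(2n+3)I\big)\eta_{n+1}-\eta_n\big(h_2(\xi_n+\xi_{n-1})+h_1+(2n-1)I\big)=0,$$ and, with $\nu_n=\tfrac12h_0+h_2\eta_n+S_n$ and $\mu_n=h_2\xi_n+h_1+(2n+1)I$, $$\nu_{n+1}^2-\nu_0^2=\eta_{n+1}\mu_n\mu_{n+1},\qquad \xi_n\mu_n=-(\nu_n+\nu_{n+1}).$$ When $h_2$ is invertible, these take, with $x_n=\mu_n^{-1}$, the form $$x_nx_{n+1}=h_2^{-1}\big(\nu_{n+1}-\tfrac12h_0-S_{n+1}\big)\big(\nu_{n+1}^2-\nu_0^2\big)^{-1},\qquad \nu_n+\nu_{n+1}=h_2^{-1}x_n^{-1}\big(h_1+(2n+1)I-x_n^{-1}\big);$$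 the first holds, with $\nu_{n+1}^2-\nu_0^2$ invertible, whenever $\mu_n$ and $\mu_{n+1}$ are invertible, the second whenever $\mu_n$ is invertible. -/

import Mathlib

noncomputable section

namespace MatrixBessel

open Set

/-- The loop minus the origin. -/
def arc (γ : Path (0 : ℂ) 0) : Set ℂ := range γ \ {0}

/-- `γ` is a simple, piecewise `C¹` loop that starts at the origin and returns to it. A simple
closed curve encircles the point at infinity exactly once, in one of the two directions; the
direction only changes the sign of all the moments, so it is left free. -/
structure IsSimpleLoop (γ : Path (0 : ℂ) 0) : Prop where
  injOn : InjOn γ {t | t ≠ 1}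
  piecewise_contDiff : ∃ s : Finset ℝ, ∀ a b : ℝ, 0 ≤ a → a < b → b ≤ 1 →
    (∀ c ∈ s, c ∉ Ioo a b) → ContDiffOn ℝ 1 γ.extend (Icc a b)

/-- The complex one-form `f(z) dz`. -/
def oneForm (f : ℂ → ℂ) (z : ℂ) : ℂ →L[ℂ] ℂ := f z • ContinuousLinearMap.id ℂ ℂ

variable {N : ℕ}

/-- The matrix `∫_γ F(z) dz / (2πi)`, computed entry by entry. -/
def loopIntegral (γ : Path (0 : ℂ) 0) (F : ℂ → Matrix (Fin N) (Fin N) ℂ) :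
    Matrix (Fin N) (Fin N) ℂ :=
  Matrix.of fun j k =>
    (2 * (Real.pi : ℂ) * Complex.I)⁻¹ * curveIntegral (oneForm fun z => F z j k) γ

/-- Weights of Bessel type on `γ`: on `γ` minus the origin every entry is a finite sum of terms
`φ(z) z ^ p (log z) ^ q exp(-c / z)` with `Re c ≥ 0`, `q ∈ ℕ`, and `φ` entire and without zeros
on `γ` (such a `φ` is Lipschitz, hence Hölder continuous, and bounded on the compact set `γ`).
Here `L` is a continuous branch of the logarithm along `γ`, and `z ^ p = exp(p L(z))`.
The entries are integrable along `γ`, so that all the moments of `W` exist. -/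
structure IsBesselWeight (γ : Path (0 : ℂ) 0) (W : ℂ → Matrix (Fin N) (Fin N) ℂ) : Prop where
  entries : ∃ L : ℂ → ℂ, ContinuousOn L (arc γ) ∧ (∀ z ∈ arc γ, Complex.exp (L z) = z) ∧
    ∀ j k : Fin N, ∃ (r : ℕ) (φ : Fin r → ℂ → ℂ) (p c : Fin r → ℂ) (q : Fin r → ℕ),
      (∀ m, Differentiable ℂ (φ m)) ∧ (∀ m, ∀ z ∈ range γ, φ m z ≠ 0) ∧
      (∀ m, 0 ≤ (c m).re) ∧
      ∀ z ∈ arc γ, W z j k =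
        ∑ m, φ m z * Complex.exp (p m * L z) * L z ^ q m * Complex.exp (-(c m) / z)
  integrable : ∀ j k : Fin N, CurveIntegrable (oneForm fun z => W z j k) γ

/-- The moment `W_n = ∫_γ z ^ n W(z) dz / (2πi)`. -/
def moment (γ : Path (0 : ℂ) 0) (W : ℂ → Matrix (Fin N) (Fin N) ℂ) (n : ℕ) :
    Matrix (Fin N) (Fin N) ℂ :=
  loopIntegral γ fun z => z ^ n • W z

/-- `W` is regular: all block Hankel determinants `det [W_{j+k}]_{j,k=0,…,n}` are nonzero. -/
def IsRegular (γ : Path (0 : ℂ) 0) (W : ℂ → Matrix (Fin N) (Fin N) ℂ) : Prop :=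
  ∀ n : ℕ, (Matrix.of fun a b : Fin (n + 1) × Fin N =>
    moment γ W ((a.1 : ℕ) + (b.1 : ℕ)) a.2 b.2).det ≠ 0

/-- The Pearson equation `z² W'(z) = (h₀ + h₁ z + h₂ z²) W(z)`, where `W'` is the complex
derivative along `γ` minus the origin. -/
def SatisfiesPearson (γ : Path (0 : ℂ) 0) (W : ℂ → Matrix (Fin N) (Fin N) ℂ)
    (h₀ h₁ h₂ : Matrix (Fin N) (Fin N) ℂ) : Prop :=
  ∀ z ∈ arc γ, ∃ W' : Matrix (Fin N) (Fin N) ℂ,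
    (∀ j k, HasDerivWithinAt (fun w => W w j k) (W' j k) (arc γ) z) ∧
    z ^ 2 • W' = (h₀ + z • h₁ + z ^ 2 • h₂) * W z

/-- `P n` is the monic left orthogonal polynomial of degree `n`, with nonsingular `C n`:
`∫_γ P_n(z) W(z) z ^ k dz / (2πi) = δ_{n,k} C_n⁻¹` for `k ≤ n`. -/
structure IsMonicLeftOrthogonal (γ : Path (0 : ℂ) 0) (W : ℂ → Matrix (Fin N) (Fin N) ℂ)
    (P : ℕ → Polynomial (Matrix (Fin N) (Fin N) ℂ)) (C : ℕ → Matrix (Fin N) (Fin N) ℂ) :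
    Prop where
  natDegree_le : ∀ n, (P n).natDegree ≤ n
  coeff_self : ∀ n, (P n).coeff n = 1
  isUnit : ∀ n, IsUnit (C n)
  orthogonal : ∀ n k, k ≤ n →
    loopIntegral γ (fun z => z ^ k • ((P n).eval (Matrix.scalar (Fin N) z) * W z)) =
      if n = k then (C n)⁻¹ else 0

/-- `ξ`, `η` are the coefficients of `z P_n = P_{n+1} + ξ_n P_n + η_n P_{n-1}`, with `P_{-1} = 0`
and the convention `η_0 = 0`. -/
structure IsRecurrence (P : ℕ → Polynomial (Matrix (Fin N) (Fin N) ℂ))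
    (ξ η : ℕ → Matrix (Fin N) (Fin N) ℂ) : Prop where
  eta_zero : η 0 = 0
  zero : Polynomial.X * P 0 = P 1 + Polynomial.C (ξ 0) * P 0
  succ : ∀ n, Polynomial.X * P (n + 1) =
    P (n + 2) + Polynomial.C (ξ (n + 1)) * P (n + 1) + Polynomial.C (η (n + 1)) * P n

/-- `∑_{k<n} ξ_k`. -/
def partialSum (ξ : ℕ → Matrix (Fin N) (Fin N) ℂ) (n : ℕ) : Matrix (Fin N) (Fin N) ℂ :=
  ∑ k ∈ Finset.range n, ξ k

/-- `C_n⁻¹ (∑_{k<m} C_k ξ_k C_k⁻¹) C_n`, that is, the partial sum of the right recurrence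
coefficients `C_k ξ_k C_k⁻¹`, conjugated by `C_n`. -/
def conjSum (C ξ : ℕ → Matrix (Fin N) (Fin N) ℂ) (n m : ℕ) : Matrix (Fin N) (Fin N) ℂ :=
  (C n)⁻¹ * (∑ k ∈ Finset.range m, C k * ξ k * (C k)⁻¹) * C n

/-- The first equation of the non-Abelian system, at `n`. -/
def FirstEquation (h₀ h₁ h₂ : Matrix (Fin N) (Fin N) ℂ)
    (C ξ η : ℕ → Matrix (Fin N) (Fin N) ℂ) (n : ℕ) : Prop :=
  (2 * (n : ℂ) + 1) • ξ n + h₀ + h₂ * (η (n + 1) + η n) + (h₂ * ξ n + h₁) * ξ n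
      + partialSum ξ n + conjSum C ξ n (n + 1) =
    ⁅partialSum ξ n, h₂⁆ * partialSum ξ (n + 1)
      - ⁅(∑ i ∈ Finset.range n, ∑ j ∈ Finset.range i, ξ i * ξ j)
          - ∑ k ∈ Finset.range n, η k, h₂⁆
      + ⁅partialSum ξ n, h₁⁆

/-- The second equation of the non-Abelian system, at `n`. For `n = 0` the terms with index
`n - 1` are multiplied by `η 0 = 0`. -/
def SecondEquation (h₁ h₂ : Matrix (Fin N) (Fin N) ℂ)
    (C ξ η : ℕ → Matrix (Fin N) (Fin N) ℂ) (n : ℕ) : Prop :=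
  ξ n ^ 2 - η n * ((2 * (n : ℂ) - 1) • 1 + h₁ + h₂ * (ξ n + ξ (n - 1)))
      + ((2 * (n : ℂ) + 3) • 1 + h₁ + h₂ * (ξ n + ξ (n + 1))) * η (n + 1) =
    ⁅partialSum ξ n, h₂⁆ * η (n + 1) - η n * ⁅partialSum ξ (n - 1), h₂⁆
      - ⁅ξ n, conjSum C ξ n n⁆

/-- `μ_n = h₂ ξ_n + h₁ + (2n+1) I`. -/
def mu (h₁ h₂ : Matrix (Fin N) (Fin N) ℂ) (ξ : ℕ → Matrix (Fin N) (Fin N) ℂ) (n : ℕ) :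
    Matrix (Fin N) (Fin N) ℂ :=
  h₂ * ξ n + h₁ + (2 * (n : ℂ) + 1) • 1

/-- `ν_n = h₀ / 2 + h₂ η_n + ∑_{k<n} ξ_k`. -/
def nu (h₀ h₂ : Matrix (Fin N) (Fin N) ℂ) (ξ η : ℕ → Matrix (Fin N) (Fin N) ℂ) (n : ℕ) :
    Matrix (Fin N) (Fin N) ℂ :=
  (1 / 2 : ℂ) • h₀ + h₂ * η n + partialSum ξ n

/-- The set of the matrices `h₀, h₁, h₂, ξ_n, η_n`. -/
def coeffSet (h₀ h₁ h₂ : Matrix (Fin N) (Fin N) ℂ) (ξ η : ℕ → Matrix (Fin N) (Fin N) ℂ) :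
    Set (Matrix (Fin N) (Fin N) ℂ) :=
  {h₀, h₁, h₂} ∪ range ξ ∪ range η

/-- The reduced, commutative system at `n`, then its two forms as a discrete Painlevé IV
equation: in `(ξ, μ, ν)` and, when the inverses involved exist, in `(x, ν)` with
`x_n = μ_n⁻¹`. Invertibility of `ν_{n+1}² - ν_0²` is part of the claim. -/
structure DiscretePainleveIV (h₀ h₁ h₂ : Matrix (Fin N) (Fin N) ℂ)
    (ξ η : ℕ → Matrix (Fin N) (Fin N) ℂ) (n : ℕ) : Prop where
  local_first : (h₂ * ξ n + h₁ + (2 * (n : ℂ) + 1) • 1) * ξ n + h₀ + h₂ * (η (n + 1) + η n)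
      + partialSum ξ n + partialSum ξ (n + 1) = 0
  local_second : ξ n ^ 2
      + (h₂ * (ξ n + ξ (n + 1)) + h₁ + (2 * (n : ℂ) + 3) • 1) * η (n + 1)
      - η n * (h₂ * (ξ n + ξ (n - 1)) + h₁ + (2 * (n : ℂ) - 1) • 1) = 0
  munu_first : nu h₀ h₂ ξ η (n + 1) ^ 2 - nu h₀ h₂ ξ η 0 ^ 2 =
      η (n + 1) * mu h₁ h₂ ξ n * mu h₁ h₂ ξ (n + 1)
  munu_second : ξ n * mu h₁ h₂ ξ n = -(nu h₀ h₂ ξ η n + nu h₀ h₂ ξ η (n + 1))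
  x_first : IsUnit h₂ → IsUnit (mu h₁ h₂ ξ n) → IsUnit (mu h₁ h₂ ξ (n + 1)) →
      IsUnit (nu h₀ h₂ ξ η (n + 1) ^ 2 - nu h₀ h₂ ξ η 0 ^ 2) ∧
      (mu h₁ h₂ ξ n)⁻¹ * (mu h₁ h₂ ξ (n + 1))⁻¹ =
        h₂⁻¹ * (nu h₀ h₂ ξ η (n + 1) - (1 / 2 : ℂ) • h₀ - partialSum ξ (n + 1)) *
          (nu h₀ h₂ ξ η (n + 1) ^ 2 - nu h₀ h₂ ξ η 0 ^ 2)⁻¹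
  x_second : IsUnit h₂ → IsUnit (mu h₁ h₂ ξ n) →
      nu h₀ h₂ ξ η n + nu h₀ h₂ ξ η (n + 1) =
        h₂⁻¹ * ((mu h₁ h₂ ξ n)⁻¹)⁻¹ *
          (h₁ + (2 * (n : ℂ) + 1) • 1 - ((mu h₁ h₂ ξ n)⁻¹)⁻¹)

end MatrixBessel

end

/-! The orthogonality conditions see only the moments, so analysis enters just twice.

The first place is integration by parts. By the Pearson equation, the derivative of `z ^ (k + 2) W`
along the loop is a combination of `z ^ k W`, `z ^ (k + 1) W` and `z ^ (k + 2) W`; integrating it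
gives a linear recursion for the moments (`momentRecursion_of_pearson`), once the boundary terms at
the origin vanish. Their limits exist because the derivative is integrable. A nonzero limit would
make `dz / z` integrable up to the origin, so the logarithm would stay finite there, which is
absurd.

The non-Abelian system is then algebra over any ring. The recursion says that `D P = (z² P)' + P (h₀
+ h₁ z + h₂ z²)` satisfies `⟨D P, z ^ k⟩ = -k ⟨P, z ^ (k + 1)⟩`. Hence `D P_n` is orthogonal to `z ^
k` for `k + 1 < n`, and is a combination of `P_{n+2}, …, P_{n-1}` (`pearsonOp_eq`). The coefficient
of `z ^ n` in this relation is the first equation; compatibility of `D (z P) = z D P + z² P` with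
the recurrence, read at `P_n`, is the second.

The second place is the commuting case. There `W = exp(-h₀ / z) z ^ h₁ exp(h₂ z) K` with `K`
constant and invertible. A constant right factor does not change left orthogonality, so whatever
commutes with the `h`'s commutes with every `ξ_n`, `η_n`. Applied to the `h`'s and then to the `ξ`'s
and `η`'s themselves, this makes all coefficients commute. The brackets vanish, the conjugated sums
become plain sums (`conj_sum_eq`), and the resulting system has a first integral
(`sq_sub_sq_eq_of_system`). -/

namespace MatrixBessel

open Polynomial

/-! ### Orthogonal polynomials over a ring: duality, recurrence, leading coefficients. -/

section Pairing

variable {R : Type*} [Ring R]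

/-- The functional `∑ᵢ Pᵢ X ^ i ↦ ∑ᵢ Pᵢ M_{i+k}` defined by a sequence of moments. -/
def pairing (M : ℕ → R) (k : ℕ) : R[X] →ₗ[R] R :=
  Polynomial.lsum fun i => LinearMap.toSpanSingleton R R (M (i + k))

lemma pairing_monomial (M : ℕ → R) (k i : ℕ) (a : R) :
    pairing M k (monomial i a) = a * M (i + k) := by
  simp [pairing, Polynomial.lsum_apply, Polynomial.sum_monomial_index]

lemma pairing_C_mul (M : ℕ → R) (k : ℕ) (a : R) (P : R[X]) :
    pairing M k (C a * P) = a * pairing M k P := by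
  rw [← smul_eq_C_mul, map_smul, smul_eq_mul]

lemma pairing_X_mul (M : ℕ → R) (k : ℕ) (P : R[X]) :
    pairing M k (X * P) = pairing M (k + 1) P := by
  induction P using Polynomial.induction_on' with
  | add p q hp hq => rw [mul_add, map_add, map_add, hp, hq]
  | monomial i a =>
    rw [X_mul_monomial, pairing_monomial, pairing_monomial, add_right_comm, add_assoc]

/-- Monic polynomials that are left orthogonal for the moments `M`, with norms `Ci n`, whose
inverses are `Cn n`. -/
structure IsOrthogonalFamily (M : ℕ → R) (P : ℕ → R[X]) (Cn Ci : ℕ → R) : Prop where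
  natDegree_le : ∀ n, (P n).natDegree ≤ n
  coeff_self : ∀ n, (P n).coeff n = 1
  mul_inv : ∀ n, Cn n * Ci n = 1
  inv_mul : ∀ n, Ci n * Cn n = 1
  orthogonal : ∀ n k, k ≤ n → pairing M k (P n) = if n = k then Ci n else 0

namespace IsOrthogonalFamily

variable {M : ℕ → R} {P : ℕ → R[X]} {Cn Ci : ℕ → R}

lemma coeff_eq_zero (h : IsOrthogonalFamily M P Cn Ci) {n k : ℕ} (hk : n < k) :
    (P n).coeff k = 0 :=
  coeff_eq_zero_of_natDegree_lt ((h.natDegree_le n).trans_lt hk)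

lemma pairing_self (h : IsOrthogonalFamily M P Cn Ci) (n : ℕ) : pairing M n (P n) = Ci n := by
  simpa using h.orthogonal n n le_rfl

lemma pairing_of_lt (h : IsOrthogonalFamily M P Cn Ci) {n k : ℕ} (hk : k < n) :
    pairing M k (P n) = 0 := by
  simpa [hk.ne'] using h.orthogonal n k hk.le

/-- `φ` plays the role of pairing with the `n`-th right orthogonal polynomial: it extracts the
coefficient of `P n` from an expansion with left coefficients, and it uses only the pairings with `z
^ k`, `k ≤ n`. -/
lemma exists_dual (h : IsOrthogonalFamily M P Cn Ci) (n : ℕ) :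
    ∃ φ : R[X] →ₗ[R] R, (∀ m, φ (P m) = if m = n then 1 else 0) ∧
      ∀ D, (∀ k ≤ n, pairing M k D = 0) → φ D = 0 := by
  induction n using Nat.strong_induction_on with
  | _ n ih =>
    choose φ hφ hφ0 using fun j : Fin n => ih j j.2
    -- Gram–Schmidt: `pairing M n` already kills `P m` for `m > n`; the sum removes its values at
    -- the `P j` with `j < n`, and the factor `Cn n` normalises the value `Ci n` at `P n`.
    refine ⟨(pairing M n - ∑ j, (φ j).smulRight (pairing M n (P j))).smulRight (Cn n), ?_, ?_⟩
    · intro m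
      simp only [LinearMap.smulRight_apply, LinearMap.sub_apply, LinearMap.sum_apply, hφ,
        smul_eq_mul]
      rcases lt_trichotomy m n with hm | rfl | hm
      · rw [Finset.sum_eq_single ⟨m, hm⟩]
        · simp [hm.ne]
        · intro j _ hj
          rw [if_neg, zero_mul]
          rintro rfl
          exact hj rfl
        · simp
      · rw [Finset.sum_eq_zero]
        · simp [h.pairing_self, h.inv_mul]
        · intro j _
          rw [if_neg j.2.ne', zero_mul]
      · rw [Finset.sum_eq_zero, h.pairing_of_lt hm]
        · simp [hm.ne']
        · intro j _
          rw [if_neg (j.2.trans hm).ne', zero_mul]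
    · intro D hD
      simp only [LinearMap.smulRight_apply, LinearMap.sub_apply, LinearMap.sum_apply, smul_eq_mul]
      rw [hD n le_rfl, Finset.sum_eq_zero]
      · simp
      · intro j _
        rw [hφ0 j D fun k hk => hD k (hk.trans j.2.le), zero_mul]

lemma exists_expansion (h : IsOrthogonalFamily M P Cn Ci) (m : ℕ) (D : R[X])
    (hD : ∀ k, m ≤ k → D.coeff k = 0) :
    ∃ a : ℕ → R, D = ∑ j ∈ Finset.range m, C (a j) * P j := by
  induction m generalizing D with
  | zero => exact ⟨0, by ext k; simp [hD k (Nat.zero_le k)]⟩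
  | succ m ih =>
    obtain ⟨a, ha⟩ := ih (D - C (D.coeff m) * P m) (by
      intro k hk
      rw [coeff_sub, coeff_C_mul]
      rcases hk.eq_or_lt with rfl | hk
      · rw [h.coeff_self, mul_one, sub_self]
      · rw [h.coeff_eq_zero hk, hD k hk, mul_zero, sub_zero])
    refine ⟨fun j => if j = m then D.coeff m else a j, ?_⟩
    simp only [Finset.sum_range_succ, if_true]
    rw [← sub_eq_iff_eq_add, ha]
    refine Finset.sum_congr rfl fun j hj => ?_
    rw [if_neg (Finset.mem_range.1 hj).ne]

/-- This nondegeneracy is the principle behind all later polynomial identities: the coefficients of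
`D` in the `P j`, `j < m`, are its images under the dual functionals, which see only vanishing
pairings. -/
lemma eq_zero_of_pairing (h : IsOrthogonalFamily M P Cn Ci) (m : ℕ) (D : R[X])
    (hD : ∀ k, m ≤ k → D.coeff k = 0) (hD0 : ∀ k < m, pairing M k D = 0) : D = 0 := by
  obtain ⟨a, ha⟩ := h.exists_expansion m D hD
  rw [ha]
  refine Finset.sum_eq_zero fun j hj => ?_
  obtain ⟨φ, hφ, hφ0⟩ := h.exists_dual j
  have hj' := Finset.mem_range.1 hj
  have h0 := hφ0 D fun k hk => hD0 k (hk.trans_lt hj')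
  rw [ha, map_sum, Finset.sum_eq_single j] at h0
  · rw [← smul_eq_C_mul, map_smul, hφ, if_pos rfl, smul_eq_mul, mul_one] at h0
    rw [h0, C_0, zero_mul]
  · intro i _ hi
    rw [← smul_eq_C_mul, map_smul, hφ, if_neg hi, smul_zero]
  · exact fun h => absurd hj h

/-- The recurrence coefficient `ξ n` and `η n` (with `η 0 = 0`), in terms of the moments. -/
lemma exists_recurrence (h : IsOrthogonalFamily M P Cn Ci) :
    ∃ ξ η : ℕ → R, η 0 = 0 ∧
      ∀ n, X * P n = P (n + 1) + C (ξ n) * P n + C (η n) * P (n - 1) := by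
  let η : ℕ → R := fun n => if n = 0 then 0 else Ci n * Cn (n - 1)
  -- Both coefficients are forced: pairing the recurrence with `z ^ (n - 1)` gives `η n`, pairing it
  -- with `z ^ n` gives `ξ n`. At `n = 0` the index `n - 1` truncates to `0`, which is harmless
  -- because `η 0 = 0`.
  refine ⟨fun n => (pairing M (n + 1) (P n) - η n * pairing M n (P (n - 1))) * Cn n, η,
    if_pos rfl, fun n => ?_⟩
  rw [add_assoc, ← sub_eq_iff_eq_add', ← sub_eq_zero]
  refine h.eq_zero_of_pairing (n + 1) _ ?_ ?_
  · intro k hk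
    obtain ⟨k, rfl⟩ : ∃ l, k = l + 1 := ⟨k - 1, by omega⟩
    simp only [coeff_sub, coeff_add, coeff_C_mul, coeff_X_mul]
    rw [h.coeff_eq_zero (n := n) (k := k + 1) (by omega),
      h.coeff_eq_zero (n := n - 1) (k := k + 1) (by omega)]
    rcases (Nat.succ_le_succ_iff.1 hk).eq_or_lt with rfl | hk
    · rw [h.coeff_self, h.coeff_self]; simp
    · rw [h.coeff_eq_zero hk, h.coeff_eq_zero (by omega)]; simp
  · intro k hk
    simp only [map_sub, map_add, pairing_C_mul, pairing_X_mul]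
    rw [h.pairing_of_lt hk, sub_zero]
    rcases (Nat.lt_succ_iff.1 hk).eq_or_lt with rfl | hk
    · rw [h.pairing_self, mul_assoc, h.mul_inv]; simp
    · rw [h.pairing_of_lt hk, mul_zero, zero_add]
      have hn : n ≠ 0 := by omega
      rcases (Nat.succ_le_iff.2 hk).eq_or_lt with rfl | hk'
      · simp [η, h.pairing_self, mul_assoc, h.mul_inv]
      · rw [h.pairing_of_lt hk', h.pairing_of_lt (by omega)]; simp

section Recurrence

variable {ξ η : ℕ → R}

lemma eta_succ (h : IsOrthogonalFamily M P Cn Ci)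
    (hrec : ∀ n, X * P n = P (n + 1) + C (ξ n) * P n + C (η n) * P (n - 1)) (n : ℕ) :
    η (n + 1) = Ci (n + 1) * Cn n := by
  have := congrArg (pairing M n) (hrec (n + 1))
  simp only [map_add, pairing_C_mul, pairing_X_mul, Nat.add_sub_cancel] at this
  rw [h.pairing_self, h.pairing_self, h.pairing_of_lt (by omega), h.pairing_of_lt (by omega),
    mul_zero, add_zero, zero_add] at this
  rw [this, mul_assoc, h.inv_mul, mul_one]

/-- Source of the conjugated sums: the first pairing beyond the orthogonality range telescopes,
since `η (n + 1) * Ci n = Ci (n + 1)`. -/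
lemma pairing_succ (h : IsOrthogonalFamily M P Cn Ci) (hη : η 0 = 0)
    (hrec : ∀ n, X * P n = P (n + 1) + C (ξ n) * P n + C (η n) * P (n - 1)) (n : ℕ) :
    pairing M (n + 1) (P n) = Ci n * ∑ k ∈ Finset.range (n + 1), Cn k * ξ k * Ci k := by
  have key (n : ℕ) : pairing M (n + 1) (P n) = ξ n * Ci n + η n * pairing M n (P (n - 1)) := by
    rw [← pairing_X_mul, hrec]
    simp only [map_add, pairing_C_mul]
    rw [h.pairing_of_lt (by omega), h.pairing_self, zero_add]
  induction n with
  | zero => rw [key, hη]; simp [← mul_assoc, h.inv_mul]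
  | succ n ih =>
    rw [key, Nat.add_sub_cancel, ih, Finset.sum_range_succ _ (n + 1), h.eta_succ hrec, mul_add,
      add_comm]
    congr 1
    · rw [mul_assoc, ← mul_assoc (Cn n), h.mul_inv, one_mul]
    · rw [← mul_assoc, ← mul_assoc, h.inv_mul, one_mul]

lemma eq_recurrence (h : IsOrthogonalFamily M P Cn Ci) {ξ' η' : ℕ → R}
    (hη : η 0 = 0) (hη' : η' 0 = 0)
    (hrec : ∀ n, X * P n = P (n + 1) + C (ξ n) * P n + C (η n) * P (n - 1))
    (hrec' : ∀ n, X * P n = P (n + 1) + C (ξ' n) * P n + C (η' n) * P (n - 1)) :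
    ξ = ξ' ∧ η = η' := by
  have h2 : η = η' := by
    funext n
    cases n with
    | zero => rw [hη, hη']
    | succ n => rw [h.eta_succ hrec, h.eta_succ hrec']
  refine ⟨?_, h2⟩
  funext n
  have := (hrec n).symm.trans (hrec' n)
  rw [h2] at this
  have := congrArg (fun Q => Q.coeff n) (add_left_cancel (add_right_cancel this))
  simpa [h.coeff_self] using this

/-- The subleading coefficients of `P n`, read off from `X * P n` so as to include `n = 0`. -/
lemma coeff_X_mul_self (h : IsOrthogonalFamily M P Cn Ci) (hη : η 0 = 0)
    (hrec : ∀ n, X * P n = P (n + 1) + C (ξ n) * P n + C (η n) * P (n - 1)) (n : ℕ) :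
    (X * P n).coeff n = -∑ k ∈ Finset.range n, ξ k := by
  induction n with
  | zero => simp
  | succ n ih =>
    have h1 := congrArg (fun Q => Q.coeff n) (hrec n)
    simp only [coeff_add, coeff_C_mul, h.coeff_self, mul_one] at h1
    -- For `n = 0` the polynomial `P (n - 1)` is `P 0`, with coefficient `1`; only `η 0 = 0` removes
    -- the term.
    have h2 : η n * (P (n - 1)).coeff n = 0 := by
      cases n with
      | zero => rw [hη, zero_mul]
      | succ n => rw [h.coeff_eq_zero (by omega), mul_zero]
    rw [ih, h2, add_zero] at h1
    rw [coeff_X_mul, Finset.sum_range_succ, neg_add, h1]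
    abel

/-- The recurrence raises the coefficient two below the top by `ξ n * S_n - η n`, where `-S_n` is
the subleading one; multiplying by `X` twice covers `n = 0` and `n = 1` as well. -/
lemma coeff_X_sq_mul_self (h : IsOrthogonalFamily M P Cn Ci) (hη : η 0 = 0)
    (hrec : ∀ n, X * P n = P (n + 1) + C (ξ n) * P n + C (η n) * P (n - 1)) (n : ℕ) :
    (X * (X * P n)).coeff n =
      (∑ i ∈ Finset.range n, ∑ j ∈ Finset.range i, ξ i * ξ j) - ∑ k ∈ Finset.range n, η k := by
  induction n with
  | zero => simp
  | succ n ih =>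
    have h1 := congrArg (fun Q => (X * Q).coeff n) (hrec n)
    have e (a : R) (Q : R[X]) : X * (C a * Q) = C a * (X * Q) := by
      rw [← mul_assoc, X_mul_C, mul_assoc]
    simp only [mul_add, e, coeff_add, coeff_C_mul] at h1
    have h2 : η n * (X * P (n - 1)).coeff n = η n := by
      cases n with
      | zero => rw [hη, zero_mul]
      | succ n => rw [Nat.add_sub_cancel, coeff_X_mul, h.coeff_self, mul_one]
    rw [ih, h2, h.coeff_X_mul_self hη hrec] at h1
    rw [coeff_X_mul, Finset.sum_range_succ, Finset.sum_range_succ, ← Finset.mul_sum]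
    rw [← sub_eq_iff_eq_add, ← sub_eq_iff_eq_add] at h1
    rw [← h1]
    noncomm_ring

end Recurrence

end IsOrthogonalFamily

end Pairing

end MatrixBessel

namespace MatrixBessel

open Polynomial

/-! ### The structure relation and the non-Abelian system. -/

section PearsonOperator

variable {R : Type*} [Ring R]

/-- The adjoint Pearson operator `P ↦ (z² P)' + P (h₀ + h₁ z + h₂ z²)`. -/
noncomputable def pearsonOp (h₀ h₁ h₂ : R) (P : R[X]) : R[X] :=
  derivative (X * (X * P)) + P * C h₀ + X * P * C h₁ + X * (X * P) * C h₂

/-- The recursion between the moments which the Pearson equation entails. -/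
def MomentRecursion (M : ℕ → R) (h₀ h₁ h₂ : R) : Prop :=
  ∀ k : ℕ, h₀ * M k + h₁ * M (k + 1) + h₂ * M (k + 2) + ((k : R) + 2) * M (k + 1) = 0

variable {h₀ h₁ h₂ : R}

lemma pearsonOp_add (P Q : R[X]) :
    pearsonOp h₀ h₁ h₂ (P + Q) = pearsonOp h₀ h₁ h₂ P + pearsonOp h₀ h₁ h₂ Q := by
  simp only [pearsonOp, mul_add, add_mul, derivative_add]
  abel

lemma pearsonOp_C_mul (a : R) (P : R[X]) :
    pearsonOp h₀ h₁ h₂ (C a * P) = C a * pearsonOp h₀ h₁ h₂ P := by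
  have e (Q : R[X]) : X * (C a * Q) = C a * (X * Q) := by
    rw [← mul_assoc, X_mul_C, mul_assoc]
  simp only [pearsonOp, e, derivative_C_mul, mul_add, mul_assoc]

lemma pearsonOp_X_mul (P : R[X]) :
    pearsonOp h₀ h₁ h₂ (X * P) = X * pearsonOp h₀ h₁ h₂ P + X * (X * P) := by
  simp only [pearsonOp, mul_add, derivative_mul, derivative_X, mul_assoc]
  noncomm_ring

/-- Integration by parts in terms of moments: formally `D P · W = (z² P W)'`, and the derivative
moves onto `z ^ k`. -/
lemma pairing_pearsonOp {M : ℕ → R} (hM : MomentRecursion M h₀ h₁ h₂) (k : ℕ) (P : R[X]) :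
    pairing M k (pearsonOp h₀ h₁ h₂ P) = -((k : R) * pairing M (k + 1) P) := by
  induction P using Polynomial.induction_on' with
  | add p q hp hq => rw [pearsonOp_add, map_add, map_add, hp, hq]; noncomm_ring
  | monomial i a =>
    have h := hM (i + k)
    simp only [pearsonOp, X_mul_monomial, derivative_monomial, monomial_mul_C, map_add,
      pairing_monomial]
    rw [show i + 1 + 1 - 1 + k = i + k + 1 by omega, show i + 1 + k = i + k + 1 by omega,
      show i + 1 + 1 + k = i + k + 2 by omega, show i + (k + 1) = i + k + 1 by omega]
    have hc (j : ℕ) : (j : R) * a = a * j := (Nat.cast_commute j a).eq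
    calc _ = a * (h₀ * M (i + k) + h₁ * M (i + k + 1) + h₂ * M (i + k + 2)
          + (((i + k : ℕ) : R) + 2) * M (i + k + 1)) - a * k * M (i + k + 1) := by
            push_cast; noncomm_ring
      _ = _ := by rw [h, ← hc]; noncomm_ring

end PearsonOperator

namespace IsOrthogonalFamily

variable {R : Type*} [Ring R] {h₀ h₁ h₂ : R}
  {M : ℕ → R} {P : ℕ → R[X]} {Cn Ci : ℕ → R} {ξ η : ℕ → R}

/-- The structure relation: the expansion of `pearsonOp (P n)` in the orthogonal polynomials. -/
lemma pearsonOp_eq (h : IsOrthogonalFamily M P Cn Ci) (hM : MomentRecursion M h₀ h₁ h₂)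
    (hη : η 0 = 0)
    (hrec : ∀ n, X * P n = P (n + 1) + C (ξ n) * P n + C (η n) * P (n - 1)) (n : ℕ) :
    pearsonOp h₀ h₁ h₂ (P n) = C h₂ * P (n + 2)
      + C ((n : R) + 2 + h₁ + h₂ * (ξ n + ξ (n + 1)) - ⁅∑ k ∈ Finset.range n, ξ k, h₂⁆) * P (n + 1)
      + C (-((n : R) * ξ n) - Ci n * (∑ k ∈ Finset.range n, Cn k * ξ k * Ci k) * Cn n) * P n
      + C (-(((n : R) - 1) * η n)) * P (n - 1) := by
  have hS (n : ℕ) := h.coeff_X_mul_self hη hrec n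
  rw [← sub_eq_zero]
  -- The coefficients of `z ^ (n + 2)` and `z ^ (n + 1)` settle the terms in `P (n + 2)` and `P (n +
  -- 1)`; the pairings with `z ^ n` and `z ^ (n - 1)` settle those in `P n` and `P (n - 1)`.
  refine h.eq_zero_of_pairing (n + 1) _ ?_ ?_
  · intro k hk
    obtain ⟨k, rfl⟩ : ∃ l, k = l + 1 := ⟨k - 1, by omega⟩
    have hk : n ≤ k := by omega
    have hX : (X * P (n + 2)).coeff (k + 2) = (P (n + 2)).coeff (k + 1) := coeff_X_mul _ _
    simp only [pearsonOp, coeff_sub, coeff_add, coeff_C_mul, coeff_mul_C, coeff_X_mul,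
      coeff_derivative]
    rw [h.coeff_eq_zero (n := n) (k := k + 1) (by omega),
      h.coeff_eq_zero (n := n - 1) (k := k + 1) (by omega)]
    rcases hk.eq_or_lt with rfl | hk
    · rw [← hX, hS, hS, h.coeff_self, h.coeff_self, Finset.sum_range_succ, Finset.sum_range_succ,
        Ring.lie_def]
      push_cast
      noncomm_ring
      norm_num
    · rw [h.coeff_eq_zero (n := n) hk, h.coeff_eq_zero (n := n + 1) (k := k + 1) (by omega)]
      obtain ⟨k, rfl⟩ : ∃ l, k = l + 1 := ⟨k - 1, by omega⟩
      rw [coeff_X_mul]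
      rcases (Nat.lt_succ_iff.1 hk).eq_or_lt with rfl | hk
      · rw [h.coeff_self, h.coeff_self]; simp
      · rw [h.coeff_eq_zero hk, h.coeff_eq_zero (by omega)]; simp
  · intro k hk
    have hT := h.pairing_succ hη hrec
    simp only [LinearMap.map_sub (pairing M k), LinearMap.map_add (pairing M k), pairing_C_mul,
      pairing_pearsonOp hM]
    rw [h.pairing_of_lt (n := n + 2) (by omega), h.pairing_of_lt hk, mul_zero, mul_zero]
    rcases (Nat.lt_succ_iff.1 hk).eq_or_lt with rfl | hk
    · rw [hT, h.pairing_self, Finset.sum_range_succ, sub_mul, mul_assoc _ (Cn k), h.mul_inv]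
      cases k with
      | zero => rw [hη]; simp
      | succ n =>
        rw [Nat.add_sub_cancel, hT, h.eta_succ hrec]
        have e : Ci (n + 1) * Cn n * (Ci n * ∑ k ∈ Finset.range (n + 1), Cn k * ξ k * Ci k)
            = Ci (n + 1) * ∑ k ∈ Finset.range (n + 1), Cn k * ξ k * Ci k := by
          rw [mul_assoc, ← mul_assoc (Cn n), h.mul_inv, one_mul]
        have e2 : Ci (n + 1) * (Cn (n + 1) * ξ (n + 1) * Ci (n + 1)) = ξ (n + 1) * Ci (n + 1) := by
          rw [← mul_assoc, ← mul_assoc, h.inv_mul, one_mul]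
        rw [mul_add (Ci (n + 1)), e2, neg_mul, neg_mul, mul_assoc _ _ (Ci n * _), e]
        push_cast
        noncomm_ring
    · have hn : n ≠ 0 := by omega
      obtain ⟨n, rfl⟩ := Nat.exists_eq_succ_of_ne_zero hn
      simp only [Nat.succ_eq_add_one, Nat.add_sub_cancel]
      rw [h.pairing_of_lt hk]
      rcases (Nat.lt_succ_iff.1 hk).eq_or_lt with rfl | hk
      · rw [h.pairing_self, h.pairing_self, h.eta_succ hrec, neg_mul, mul_assoc _ _ (Ci k),
          mul_assoc _ _ (Ci k), h.mul_inv]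
        push_cast
        noncomm_ring
      · rw [h.pairing_of_lt hk, h.pairing_of_lt (by omega)]
        noncomm_ring

/-- The first equation of the non-Abelian system. -/
lemma first_equation (h : IsOrthogonalFamily M P Cn Ci) (hM : MomentRecursion M h₀ h₁ h₂)
    (hη : η 0 = 0)
    (hrec : ∀ n, X * P n = P (n + 1) + C (ξ n) * P n + C (η n) * P (n - 1)) (n : ℕ) :
    (2 * (n : R) + 1) * ξ n + h₀ + h₂ * (η (n + 1) + η n) + (h₂ * ξ n + h₁) * ξ n
      + ∑ k ∈ Finset.range n, ξ k
      + Ci n * (∑ k ∈ Finset.range (n + 1), Cn k * ξ k * Ci k) * Cn n =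
    ⁅∑ k ∈ Finset.range n, ξ k, h₂⁆ * ∑ k ∈ Finset.range (n + 1), ξ k
      - ⁅(∑ i ∈ Finset.range n, ∑ j ∈ Finset.range i, ξ i * ξ j)
          - ∑ k ∈ Finset.range n, η k, h₂⁆
      + ⁅∑ k ∈ Finset.range n, ξ k, h₁⁆ := by
  have hS := h.coeff_X_mul_self hη hrec
  have hQ := h.coeff_X_sq_mul_self hη hrec
  -- The structure relation was determined by higher coefficients and by pairings; its coefficient
  -- of `z ^ n` is new information.
  have h1 := congrArg (fun Q => Q.coeff n) (h.pearsonOp_eq hM hη hrec n)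
  have hX1 : (P (n + 1)).coeff n = (X * P (n + 1)).coeff (n + 1) := (coeff_X_mul _ _).symm
  have hX2 : (P (n + 2)).coeff n = (X * (X * P (n + 2))).coeff (n + 2) := by
    rw [coeff_X_mul, coeff_X_mul]
  have hB : η n * (P (n - 1)).coeff n = 0 := by
    cases n with
    | zero => rw [hη, zero_mul]
    | succ n => rw [h.coeff_eq_zero (by omega), mul_zero]
  simp only [pearsonOp, coeff_add, coeff_C_mul, coeff_mul_C, coeff_derivative, h.coeff_self] at h1
  rw [coeff_X_mul (X * P n) n, hX1, hX2, neg_mul (((n : R) - 1) * η n), mul_assoc _ _ (coeff _ n),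
    hB, hS, hS, hQ, hQ] at h1
  have e : Ci n * (Cn n * ξ n * Ci n) * Cn n = ξ n := by
    rw [mul_assoc (Cn n), ← mul_assoc (Ci n), h.inv_mul, one_mul, mul_assoc, h.inv_mul, mul_one]
  simp only [Finset.sum_range_succ, Ring.lie_def, ← Finset.mul_sum] at h1 ⊢
  rw [mul_add (Ci n), add_mul _ _ (Cn n), e]
  generalize (∑ k ∈ Finset.range n, ξ k) = S at *
  generalize (∑ k ∈ Finset.range n, η k) = E at *
  generalize (∑ i ∈ Finset.range n, ∑ j ∈ Finset.range i, ξ i * ξ j) = F at *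
  generalize Ci n * (∑ k ∈ Finset.range n, Cn k * ξ k * Ci k) * Cn n = T at *
  -- Differentiation puts the integer factor to the right of the coefficient, and it has to pass to
  -- the left.
  have hc : S * (n : R) = n * S := (Nat.cast_commute n S).eq.symm
  linear_combination (norm := (noncomm_ring; try norm_num)) h1 + hc

/-- The second equation of the non-Abelian system. -/
lemma second_equation (h : IsOrthogonalFamily M P Cn Ci) (hM : MomentRecursion M h₀ h₁ h₂)
    (hη : η 0 = 0)
    (hrec : ∀ n, X * P n = P (n + 1) + C (ξ n) * P n + C (η n) * P (n - 1)) (n : ℕ) :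
    ξ n ^ 2 - η n * ((2 * (n : R) - 1) + h₁ + h₂ * (ξ n + ξ (n - 1)))
      + ((2 * (n : R) + 3) + h₁ + h₂ * (ξ n + ξ (n + 1))) * η (n + 1) =
    ⁅∑ k ∈ Finset.range n, ξ k, h₂⁆ * η (n + 1) - η n * ⁅∑ k ∈ Finset.range (n - 1), ξ k, h₂⁆
      - ⁅ξ n, Ci n * (∑ k ∈ Finset.range n, Cn k * ξ k * Ci k) * Cn n⁆ := by
  obtain ⟨φ, hφ, -⟩ := h.exists_dual n
  have hφC (a : R) (Q : R[X]) : φ (C a * Q) = a * φ Q := by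
    rw [← smul_eq_C_mul, map_smul, smul_eq_mul]
  obtain ⟨a, ha⟩ : ∃ a : ℕ → R, ∀ n, a n = (n : R) + 2 + h₁ + h₂ * (ξ n + ξ (n + 1))
      - ⁅∑ k ∈ Finset.range n, ξ k, h₂⁆ := ⟨_, fun _ => rfl⟩
  obtain ⟨b, hb⟩ : ∃ b : ℕ → R, ∀ n, b n = -((n : R) * ξ n)
      - Ci n * (∑ k ∈ Finset.range n, Cn k * ξ k * Ci k) * Cn n := ⟨_, fun _ => rfl⟩
  obtain ⟨c, hc⟩ : ∃ c : ℕ → R, ∀ n, c n = -(((n : R) - 1) * η n) := ⟨_, fun _ => rfl⟩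
  have hD := h.pearsonOp_eq hM hη hrec
  simp only [← ha, ← hb, ← hc] at hD
  have e (a : R) (Q : R[X]) : X * (C a * Q) = C a * (X * Q) := by
    rw [← mul_assoc, X_mul_C, mul_assoc]
  -- With the recurrence and the structure relation, both sides become combinations of the `P m`;
  -- `φ` compares the coefficients of `P n`.
  have h1 := congrArg φ (pearsonOp_X_mul (h₀ := h₀) (h₁ := h₁) (h₂ := h₂) (P n))
  rw [hrec n] at h1
  simp only [pearsonOp_add, pearsonOp_C_mul, hD, mul_add, e, hrec, map_add, hφC, hφ] at h1
  -- At `n = 0` the index `n - 1` coincides with `n`, so `φ` does not discard the term in `P (n -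
  -- 1)`; it vanishes through `η 0 = 0`.
  cases n with
  | zero =>
    simp [hη, hc, hb, ha] at h1
    simp only [hη, Ring.lie_def, Finset.range_zero, Finset.sum_empty] at h1 ⊢
    push_cast
    linear_combination (norm := (noncomm_ring; try norm_num)) -h1
  | succ n =>
    have e1 : n - 1 ≠ n + 1 := by omega
    have e2 : n + 1 + 1 ≠ n := by omega
    have e3 : n + 1 + 2 ≠ n := by omega
    simp [e1, e2, e3] at h1
    rw [hc, hc, hb, ha, ha] at h1
    have hc1 : η (n + 1) * (n : R) = n * η (n + 1) := (Nat.cast_commute n _).eq.symm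
    have hc2 : ξ (n + 1) * (n : R) = n * ξ (n + 1) := (Nat.cast_commute n _).eq.symm
    have hc3 : ξ (n + 1) * ((n : R) * ξ (n + 1)) = n * (ξ (n + 1) * ξ (n + 1)) := by
      rw [← mul_assoc, hc2, mul_assoc]
    simp only [Nat.add_sub_cancel, Ring.lie_def] at h1 ⊢
    push_cast at h1 ⊢
    generalize Ci (n + 1) * (∑ k ∈ Finset.range (n + 1), Cn k * ξ k * Ci k) * Cn (n + 1) = T at *
    linear_combination (norm := (noncomm_ring; try norm_num)) -h1 - hc1 - hc3

end IsOrthogonalFamily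
end MatrixBessel

namespace MatrixBessel

open Polynomial

/-! ### Commutation of the coefficients, and the first integral. -/

section Commuting

variable {R : Type*} [Ring R]

lemma pairing_mul_C {M M' : ℕ → R} {K B : R} (hB : ∀ k, Commute B (M' k))
    (hM : ∀ k, M k = M' k * K) (k : ℕ) (P : R[X]) :
    pairing M k (P * C B) = pairing M' k P * B * K := by
  induction P using Polynomial.induction_on' with
  | add p q hp hq => rw [add_mul, map_add, map_add, hp, hq, add_mul, add_mul]
  | monomial i a =>
    rw [monomial_mul_C, pairing_monomial, pairing_monomial, hM, mul_assoc a (M' _), ← (hB _).eq,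
      mul_assoc, mul_assoc, mul_assoc]

namespace IsOrthogonalFamily

variable {M : ℕ → R} {P : ℕ → R[X]} {Cn Ci : ℕ → R} {ξ η : ℕ → R}

/-- What commutes with the moments up to a common right factor commutes with the orthogonal
polynomials. -/
lemma commute_polynomial (h : IsOrthogonalFamily M P Cn Ci) {M' : ℕ → R} {K Ki B : R}
    (hK : K * Ki = 1) (hB : ∀ k, Commute B (M' k)) (hM : ∀ k, M k = M' k * K) (n : ℕ) :
    Commute (C B) (P n) := by
  rw [commute_iff_eq, ← sub_eq_zero]
  refine h.eq_zero_of_pairing n _ ?_ ?_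
  · intro k hk
    rw [coeff_sub, coeff_C_mul, coeff_mul_C]
    rcases hk.eq_or_lt with rfl | hk
    · rw [h.coeff_self, mul_one, one_mul, sub_self]
    · rw [h.coeff_eq_zero hk, mul_zero, zero_mul, sub_self]
  · intro k hk
    have h1 : pairing M k (P n) = pairing M' k (P n) * K := by
      simpa using pairing_mul_C (B := 1) (fun k => Commute.one_left _) hM k (P n)
    have h2 : pairing M' k (P n) = 0 := by
      rw [h.pairing_of_lt hk] at h1
      rw [← mul_one (pairing M' k (P n)), ← hK, ← mul_assoc, ← h1, zero_mul]
    rw [map_sub, pairing_C_mul, h.pairing_of_lt hk, pairing_mul_C hB hM, h2]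
    simp

/-- Commuting `B` past `X * P n - P (n + 1)` leaves `[B, ξ n] P n + [B, η n] P (n - 1) = 0`;
monicity then kills both brackets in turn. -/
lemma commute_recurrence (h : IsOrthogonalFamily M P Cn Ci) (hη : η 0 = 0)
    (hrec : ∀ n, X * P n = P (n + 1) + C (ξ n) * P n + C (η n) * P (n - 1))
    {B : R} (hB : ∀ n, Commute (C B) (P n)) (n : ℕ) :
    Commute B (ξ n) ∧ Commute B (η n) := by
  have h1 : Commute (C B) (C (ξ n) * P n + C (η n) * P (n - 1)) := by
    have h2 : C (ξ n) * P n + C (η n) * P (n - 1) = X * P n - P (n + 1) := by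
      rw [hrec, add_assoc, add_sub_cancel_left]
    rw [h2]
    exact ((commute_X (C B)).symm.mul_right (hB n)).sub_right (hB _)
  have h3 : C (B * ξ n - ξ n * B) * P n + C (B * η n - η n * B) * P (n - 1) = 0 := by
    have e (a : R) (m : ℕ) : C a * P m * C B = C (a * B) * P m := by
      rw [mul_assoc, ← (hB m).eq, ← mul_assoc, C_mul]
    have h4 := h1.eq
    rw [mul_add, add_mul, e, e, ← mul_assoc, ← mul_assoc, ← C_mul, ← C_mul] at h4
    rw [C_sub, C_sub, sub_mul, sub_mul, sub_add_sub_comm, h4, sub_self]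
  have h5 : B * η n - η n * B = 0 ∨ n ≠ 0 := by
    rcases eq_or_ne n 0 with rfl | hn
    · simp [hη]
    · exact Or.inr hn
  have h6 : B * ξ n - ξ n * B = 0 := by
    have h7 := congrArg (fun Q => Q.coeff n) h3
    simp only [coeff_add, coeff_C_mul, h.coeff_self, mul_one, coeff_zero] at h7
    rcases h5 with h5 | h5
    · simpa [h5] using h7
    · simpa [h.coeff_eq_zero (show n - 1 < n by omega)] using h7
  refine ⟨sub_eq_zero.1 h6, sub_eq_zero.1 ?_⟩
  have h7 := congrArg (fun Q => Q.coeff (n - 1)) h3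
  rw [h6, C_0, zero_mul, zero_add, coeff_C_mul, h.coeff_self, mul_one, coeff_zero] at h7
  exact h7

/-- The `Cn k` themselves need not commute with the `ξ j`, but `Ci n * Cn k = η n ⋯ η (k + 1)` does,
so the conjugations cancel termwise. -/
lemma conj_sum_eq (h : IsOrthogonalFamily M P Cn Ci)
    (hrec : ∀ n, X * P n = P (n + 1) + C (ξ n) * P n + C (η n) * P (n - 1))
    (hcomm : ∀ i j, Commute (η i) (ξ j)) {n m : ℕ} (hm : m ≤ n + 1) :
    Ci n * (∑ k ∈ Finset.range m, Cn k * ξ k * Ci k) * Cn n = ∑ k ∈ Finset.range m, ξ k := by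
  have key (n k j : ℕ) (hk : k ≤ n) : Commute (Ci n * Cn k) (ξ j) := by
    induction n with
    | zero =>
      obtain rfl : k = 0 := by omega
      rw [h.inv_mul]
      exact Commute.one_left _
    | succ n ih =>
      rcases hk.eq_or_lt with rfl | hk
      · rw [h.inv_mul]
        exact Commute.one_left _
      · have : Ci (n + 1) * Cn k = η (n + 1) * (Ci n * Cn k) := by
          rw [h.eta_succ hrec, mul_assoc, ← mul_assoc (Cn n), h.mul_inv, one_mul]
        rw [this]
        exact (hcomm _ _).mul_left (ih (by omega))
  rw [Finset.mul_sum, Finset.sum_mul]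
  refine Finset.sum_congr rfl fun k hk => ?_
  have hk : k ≤ n := by have := Finset.mem_range.1 hk; omega
  rw [← mul_assoc, ← mul_assoc, (key n k k hk).eq, mul_assoc _ (Ci k), mul_assoc (ξ k),
    mul_assoc (Ci n), ← mul_assoc (Cn k), h.mul_inv, one_mul, h.inv_mul, mul_one]

end IsOrthogonalFamily

/-- The first integral of the commutative system. -/
lemma sq_sub_sq_eq_of_system {A : Type*} [CommRing A] {a h₁ h₂ : A} {ξ η : ℕ → A} (hη : η 0 = 0)
    (first : ∀ n : ℕ, (h₂ * ξ n + h₁ + (2 * (n : A) + 1)) * ξ n + 2 * a + h₂ * (η (n + 1) + η n)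
      + ∑ k ∈ Finset.range n, ξ k + ∑ k ∈ Finset.range (n + 1), ξ k = 0)
    (second : ∀ n : ℕ, ξ n ^ 2 + (h₂ * (ξ n + ξ (n + 1)) + h₁ + (2 * (n : A) + 3)) * η (n + 1)
      - η n * (h₂ * (ξ n + ξ (n - 1)) + h₁ + (2 * (n : A) - 1)) = 0) (n : ℕ) :
    (a + h₂ * η (n + 1) + ∑ k ∈ Finset.range (n + 1), ξ k) ^ 2 - a ^ 2 =
      η (n + 1) * (h₂ * ξ n + h₁ + (2 * (n : A) + 1)) *
        (h₂ * ξ (n + 1) + h₁ + (2 * ((n + 1 : ℕ) : A) + 1)) := by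
  induction n with
  | zero =>
    have h1 := first 0
    have h2 := second 0
    simp [hη] at h1 h2 ⊢
    linear_combination (h₂ * η 1 + ξ 0) * h1 - (h₂ * ξ 0 + h₁ + 1) * h2
  | succ n ih =>
    have h1 := first (n + 1)
    have h2 := second (n + 1)
    rw [Nat.add_sub_cancel] at h2
    rw [Finset.sum_range_succ _ (n + 1)] at h1 ⊢
    push_cast at *
    generalize (∑ k ∈ Finset.range (n + 1), ξ k) = S at *
    -- The multiplier of `h1` is `ν_{n+2} - ν_{n+1}`, because `h1` reads `ν_{n+1} + ν_{n+2} =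
    -- -ξ_{n+1} μ_{n+1}` and the product is a difference of squares; the multiplier of `h2` is
    -- `μ_{n+1}`.
    linear_combination ih + (h₂ * (η (n + 2) - η (n + 1)) + ξ (n + 1)) * h1
      - (h₂ * ξ (n + 1) + h₁ + (2 * (n + 1) + 1)) * h2

end Commuting

end MatrixBessel

namespace MatrixBessel

open Set Filter Topology MeasureTheory

/-! ### Calculus along the loop and vanishing of boundary terms. -/

section LoopCalculus

variable {γ : Path (0 : ℂ) 0}

lemma IsSimpleLoop.extend_mem_arc (hγ : IsSimpleLoop γ) {t : ℝ} (ht : t ∈ Ioo (0 : ℝ) 1) :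
    γ.extend t ∈ arc γ := by
  have htI : t ∈ Icc (0 : ℝ) 1 := Ioo_subset_Icc_self ht
  rw [γ.extend_apply htI]
  refine ⟨mem_range_self _, fun h => ?_⟩
  have h1 : (⟨t, htI⟩ : unitInterval) ≠ 1 := fun h => ht.2.ne (congrArg Subtype.val h)
  have h2 := hγ.injOn h1 (show (0 : unitInterval) ≠ 1 from zero_ne_one)
    (by rw [mem_singleton_iff.1 h, γ.source])
  exact ht.1.ne' (congrArg Subtype.val h2)

lemma IsSimpleLoop.exists_hasDerivAt (hγ : IsSimpleLoop γ) :
    ∃ s : Set ℝ, s.Countable ∧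
      ∀ t ∈ Ioo (0 : ℝ) 1 \ s, HasDerivAt γ.extend (deriv γ.extend t) t := by
  obtain ⟨s, hs⟩ := hγ.piecewise_contDiff
  refine ⟨s, s.countable_toSet, fun t ht => ?_⟩
  have hopen : IsOpen (Ioo (0 : ℝ) 1 \ (s : Set ℝ)) := isOpen_Ioo.sdiff s.finite_toSet.isClosed
  obtain ⟨ε, hε, hball⟩ := Metric.isOpen_iff.1 hopen t ht
  have hsub : Ioo (t - ε) (t + ε) ⊆ Ioo (0 : ℝ) 1 \ (s : Set ℝ) := by
    rwa [← Real.ball_eq_Ioo]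
  have hmem (x : ℝ) (h1 : t - ε < x) (h2 : x < t + ε) := hsub ⟨h1, h2⟩
  have ha := hmem (t - ε / 2) (by linarith) (by linarith)
  have hb := hmem (t + ε / 2) (by linarith) (by linarith)
  have hd := hs (t - ε / 2) (t + ε / 2) ha.1.1.le (by linarith) hb.1.2.le fun c hc hc' =>
    (hmem c (by linarith [hc'.1]) (by linarith [hc'.2])).2 hc
  exact ((hd.differentiableOn one_ne_zero).differentiableAt
    (Icc_mem_nhds (by linarith) (by linarith))).hasDerivAt

lemma curveIntegral_oneForm (f : ℂ → ℂ) :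
    curveIntegral (oneForm f) γ = ∫ t in (0 : ℝ)..1, f (γ.extend t) * deriv γ.extend t := by
  rw [curveIntegral_eq_intervalIntegral_deriv]
  simp [oneForm]

lemma curveIntegrable_oneForm_iff (f : ℂ → ℂ) : CurveIntegrable (oneForm f) γ ↔
    IntervalIntegrable (fun t => f (γ.extend t) * deriv γ.extend t) volume 0 1 := by
  rw [CurveIntegrable]
  apply intervalIntegrable_congr_ae
  rw [uIoc_of_le zero_le_one, ← restrict_Ioo_eq_restrict_Ioc]
  filter_upwards [ae_restrict_mem measurableSet_Ioo] with x hx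
  rw [curveIntegralFun_def, derivWithin_of_mem_nhds (by simpa using Icc_mem_nhds hx.1 hx.2)]
  simp [oneForm]

/-- A primitive of an integrable function has limits at both ends of the interval. -/
lemma exists_tendsto_of_hasDerivAt_off_countable {E : Type*} [NormedAddCommGroup E]
    [NormedSpace ℝ E] [CompleteSpace E] {a b : ℝ} (hab : a < b) {G d : ℝ → E} {s : Set ℝ}
    (hs : s.Countable) (hG : ContinuousOn G (Ioo a b))
    (hd : ∀ t ∈ Ioo a b \ s, HasDerivAt G (d t) t) (hi : IntervalIntegrable d volume a b) :
    ∃ l₀ l₁, Tendsto G (𝓝[>] a) (𝓝 l₀) ∧ Tendsto G (𝓝[<] b) (𝓝 l₁) ∧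
      ∫ t in a..b, d t = l₁ - l₀ := by
  obtain ⟨c, hac, hcb⟩ := exists_between hab
  have hc : c ∈ uIcc a b := by rw [uIcc_of_le hab.le]; exact ⟨hac.le, hcb.le⟩
  have hcont : ContinuousOn (fun t => ∫ x in c..t, d x) (Icc a b) := by
    have := intervalIntegral.continuousOn_primitive_interval' hi hc
    rwa [uIcc_of_le hab.le] at this
  have hsub {t : ℝ} (ht : t ∈ Ioo a b) : uIcc c t ⊆ Ioo a b :=
    OrdConnected.uIcc_subset ordConnected_Ioo ⟨hac, hcb⟩ ht
  have hprim : ∀ t ∈ Ioo a b, G c + ∫ x in c..t, d x = G t := by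
    intro t ht
    rw [integral_eq_of_hasDerivAt_off_countable G d hs (hG.mono (hsub ht))
      (fun x hx => hd x ⟨hsub ht (Ioo_subset_Icc_self hx.1), hx.2⟩)
      (hi.mono_set (by
        rw [uIcc_of_le hab.le]; exact (hsub ht).trans Ioo_subset_Icc_self))]
    abel
  refine ⟨G c + ∫ x in c..a, d x, G c + ∫ x in c..b, d x, ?_, ?_, ?_⟩
  · have h1 : Tendsto (fun t => ∫ x in c..t, d x) (𝓝[>] a) (𝓝 (∫ x in c..a, d x)) :=
      (hcont a (left_mem_Icc.2 hab.le)).mono_left <| by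
        rw [← nhdsWithin_Ioo_eq_nhdsGT hab]
        exact nhdsWithin_mono _ Ioo_subset_Icc_self
    refine (h1.const_add (G c)).congr' ?_
    filter_upwards [Ioo_mem_nhdsGT hab] with t ht using hprim t ht
  · have h1 : Tendsto (fun t => ∫ x in c..t, d x) (𝓝[<] b) (𝓝 (∫ x in c..b, d x)) :=
      (hcont b (right_mem_Icc.2 hab.le)).mono_left <| by
        rw [← nhdsWithin_Ioo_eq_nhdsLT hab]
        exact nhdsWithin_mono _ Ioo_subset_Icc_self
    refine (h1.const_add (G c)).congr' ?_
    filter_upwards [Ioo_mem_nhdsLT hab] with t ht using hprim t ht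
  · have h1 : IntervalIntegrable d volume a c := hi.mono_set (by
      rw [uIcc_of_le hab.le, uIcc_of_le hac.le]; exact Icc_subset_Icc_right hcb.le)
    have h2 : IntervalIntegrable d volume c b := hi.mono_set (by
      rw [uIcc_of_le hab.le, uIcc_of_le hcb.le]; exact Icc_subset_Icc_left hac.le)
    rw [← intervalIntegral.integral_add_adjacent_intervals h1 h2,
      intervalIntegral.integral_symm a c]
    abel

/-- The derivative of a continuous logarithm along a curve. -/
lemma hasDerivAt_of_exp_eq {g m : ℝ → ℂ} {g' : ℂ} {t : ℝ} (hg : HasDerivAt g g' t)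
    (hm : ContinuousAt m t) (hexp : ∀ᶠ x in 𝓝 t, Complex.exp (m x) = g x) :
    HasDerivAt m (g' / g t) t := by
  have h0 : g t ≠ 0 := by
    rw [← hexp.self_of_nhds]
    exact Complex.exp_ne_zero _
  -- Near `t` this function is `m` itself: continuity keeps the imaginary part of `m x - m t` within
  -- `(-π, π)`, where the principal logarithm inverts `exp`.
  have h1 : HasDerivAt (fun x => m t + Complex.log (g x / g t)) (g' / g t) t := by
    have h2 : HasDerivAt (fun x => g x / g t) (g' / g t) t := hg.div_const _
    have h3 := h2.clog_real (by rw [div_self h0]; exact Complex.one_mem_slitPlane)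
    rw [div_self h0, div_one] at h3
    exact h3.const_add _
  refine h1.congr_of_eventuallyEq ?_
  have h4 : ∀ᶠ x in 𝓝 t, |(m x - m t).im| < Real.pi := by
    have h5 : ContinuousAt (fun x => |(m x - m t).im|) t :=
      (Complex.continuous_im.continuousAt.comp (hm.sub continuousAt_const)).abs
    exact h5.eventually_lt continuousAt_const (by simpa using Real.pi_pos)
  filter_upwards [hexp, h4] with x hx hx'
  have h6 : Complex.exp (m x - m t) = g x / g t := by
    rw [Complex.exp_sub, hx, hexp.self_of_nhds]
  rw [← h6, Complex.log_exp (abs_lt.1 hx').1 (abs_lt.1 hx').2.le]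
  ring

/-- Where `z ^ (k + 2) u` stays away from zero and `u dz` is integrable, the curve stays away
from the origin. -/
lemma ne_zero_of_tendsto_of_norm_ge (hγ : IsSimpleLoop γ) {L : ℂ → ℂ}
    (hL : ContinuousOn L (arc γ)) (hexp : ∀ z ∈ arc γ, Complex.exp (L z) = z) {a b c : ℝ}
    (ha : 0 ≤ a) (hab : a < b) (hb : b ≤ 1) (hc : 0 < c) {k : ℕ} {u : ℝ → ℂ}
    (hu : ∀ t ∈ Ioo a b, c ≤ ‖γ.extend t ^ (k + 2) * u t‖)
    (hi : IntervalIntegrable (fun t => u t * deriv γ.extend t) volume 0 1) :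
    γ.extend a ≠ 0 ∧ γ.extend b ≠ 0 := by
  have hsub : Ioo a b ⊆ Ioo 0 1 := Ioo_subset_Ioo ha hb
  have hcont := γ.continuous_extend
  obtain ⟨s, hs, hd⟩ := hγ.exists_hasDerivAt
  have hmaps : MapsTo γ.extend (Ioo a b) (arc γ) := fun t ht => hγ.extend_mem_arc (hsub ht)
  have hLc : ContinuousOn (fun t => L (γ.extend t)) (Ioo a b) :=
    hL.comp hcont.continuousOn hmaps
  have hLd : ∀ t ∈ Ioo a b \ s,
      HasDerivAt (fun t => L (γ.extend t)) (deriv γ.extend t / γ.extend t) t := by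
    intro t ht
    refine hasDerivAt_of_exp_eq (hd t ⟨hsub ht.1, ht.2⟩)
      (hLc.continuousAt (isOpen_Ioo.mem_nhds ht.1)) ?_
    filter_upwards [isOpen_Ioo.mem_nhds ht.1] with x hx using hexp _ (hmaps hx)
  -- The lower bound on `‖γ ^ (k + 2) u‖` gives `‖γ' / γ‖ ≤ c⁻¹ ‖γ ^ (k + 1) u γ'‖`, which is
  -- integrable.
  have hi' : IntervalIntegrable (fun t => deriv γ.extend t / γ.extend t) volume a b := by
    have h1 : IntervalIntegrable
        (fun t => (c⁻¹ : ℂ) * γ.extend t ^ (k + 1) * (u t * deriv γ.extend t)) volume a b := by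
      refine IntervalIntegrable.continuousOn_mul (hi.mono_set ?_) (by fun_prop)
      rw [uIcc_of_le hab.le, uIcc_of_le zero_le_one]
      exact Icc_subset_Icc ha hb
    refine h1.mono_fun
      ((measurable_deriv _).div hcont.measurable).aestronglyMeasurable ?_
    rw [uIoc_of_le hab.le, ← restrict_Ioo_eq_restrict_Ioc]
    filter_upwards [ae_restrict_mem measurableSet_Ioo] with t ht
    have hg : γ.extend t ≠ 0 := (hmaps ht).2
    have h2 : (c⁻¹ : ℂ) * γ.extend t ^ (k + 1) * (u t * deriv γ.extend t) =
        ((c : ℂ)⁻¹ * (γ.extend t ^ (k + 2) * u t)) * (deriv γ.extend t / γ.extend t) := by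
      rw [pow_succ _ (k + 1)]
      field_simp
    rw [h2, norm_mul]
    refine le_mul_of_one_le_left (norm_nonneg _) ?_
    rw [norm_mul, norm_inv, Complex.norm_real, Real.norm_of_nonneg hc.le,
      le_inv_mul_iff₀ hc, mul_one]
    exact hu t ht
  -- Having an integrable derivative, the logarithm along the curve has finite limits at `a` and
  -- `b`; there `γ` is the exponential of a limit, hence nonzero.
  obtain ⟨l₀, l₁, h0, h1, -⟩ := exists_tendsto_of_hasDerivAt_off_countable hab hs hLc hLd hi'
  constructor
  · have h2 : Tendsto γ.extend (𝓝[>] a) (𝓝 (Complex.exp l₀)) := by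
      refine ((Complex.continuous_exp.tendsto l₀).comp h0).congr' ?_
      filter_upwards [Ioo_mem_nhdsGT hab] with t ht using hexp _ (hmaps ht)
    rw [tendsto_nhds_unique (hcont.continuousAt.tendsto.mono_left nhdsWithin_le_nhds) h2]
    exact Complex.exp_ne_zero _
  · have h2 : Tendsto γ.extend (𝓝[<] b) (𝓝 (Complex.exp l₁)) := by
      refine ((Complex.continuous_exp.tendsto l₁).comp h1).congr' ?_
      filter_upwards [Ioo_mem_nhdsLT hab] with t ht using hexp _ (hmaps ht)
    rw [tendsto_nhds_unique (hcont.continuousAt.tendsto.mono_left nhdsWithin_le_nhds) h2]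
    exact Complex.exp_ne_zero _

/-- A nonzero limit would bound `z ^ (k + 2) u` away from zero near the starting point, forcing `γ 0
≠ 0`. -/
lemma eq_zero_of_tendsto_zero (hγ : IsSimpleLoop γ) {L : ℂ → ℂ}
    (hL : ContinuousOn L (arc γ)) (hexp : ∀ z ∈ arc γ, Complex.exp (L z) = z) {k : ℕ} {u : ℝ → ℂ}
    (hi : IntervalIntegrable (fun t => u t * deriv γ.extend t) volume 0 1) {l : ℂ}
    (hl : Tendsto (fun t => γ.extend t ^ (k + 2) * u t) (𝓝[>] 0) (𝓝 l)) : l = 0 := by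
  by_contra hl0
  have hpos : 0 < ‖l‖ := norm_pos_iff.2 hl0
  have h1 : ∀ᶠ t in 𝓝[>] (0 : ℝ), ‖l‖ / 2 < ‖γ.extend t ^ (k + 2) * u t‖ :=
    hl.norm.eventually (lt_mem_nhds (half_lt_self hpos))
  obtain ⟨δ, hδ, h2⟩ := mem_nhdsGT_iff_exists_Ioo_subset.1 h1
  refine (ne_zero_of_tendsto_of_norm_ge hγ hL hexp (k := k) le_rfl (b := min δ 1)
    (lt_min hδ one_pos) (min_le_right _ _) (half_pos hpos) (fun t ht => ?_) hi).1 (by simp)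
  exact (h2 ⟨ht.1, ht.2.trans_le (min_le_left _ _)⟩ : _ < _).le

lemma eq_zero_of_tendsto_one (hγ : IsSimpleLoop γ) {L : ℂ → ℂ}
    (hL : ContinuousOn L (arc γ)) (hexp : ∀ z ∈ arc γ, Complex.exp (L z) = z) {k : ℕ} {u : ℝ → ℂ}
    (hi : IntervalIntegrable (fun t => u t * deriv γ.extend t) volume 0 1) {l : ℂ}
    (hl : Tendsto (fun t => γ.extend t ^ (k + 2) * u t) (𝓝[<] 1) (𝓝 l)) : l = 0 := by
  by_contra hl0
  have hpos : 0 < ‖l‖ := norm_pos_iff.2 hl0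
  have h1 : ∀ᶠ t in 𝓝[<] (1 : ℝ), ‖l‖ / 2 < ‖γ.extend t ^ (k + 2) * u t‖ :=
    hl.norm.eventually (lt_mem_nhds (half_lt_self hpos))
  obtain ⟨δ, hδ, h2⟩ := mem_nhdsLT_iff_exists_Ioo_subset.1 h1
  refine (ne_zero_of_tendsto_of_norm_ge hγ hL hexp (k := k) (a := max δ 0) (le_max_right _ _)
    (max_lt hδ one_pos) le_rfl (half_pos hpos) (fun t ht => ?_) hi).2 (by simp)
  exact (h2 ⟨(le_max_left _ _).trans_lt ht.1, ht.2⟩ : _ < _).le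

end LoopCalculus

end MatrixBessel

namespace MatrixBessel

open Set Filter Topology MeasureTheory

/-! ### From loop integrals to moments, and the moment recursion. -/

section LoopIntegral

variable {N : ℕ} {γ : Path (0 : ℂ) 0} {W F G : ℂ → Matrix (Fin N) (Fin N) ℂ}

/-- Entrywise integrability along the loop. -/
def IsLoopIntegrable (γ : Path (0 : ℂ) 0) (F : ℂ → Matrix (Fin N) (Fin N) ℂ) : Prop :=
  ∀ j k : Fin N,
    IntervalIntegrable (fun t => F (γ.extend t) j k * deriv γ.extend t) volume 0 1

lemma IsBesselWeight.isLoopIntegrable (hW : IsBesselWeight γ W) : IsLoopIntegrable γ W :=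
  fun j k => (curveIntegrable_oneForm_iff _).1 (hW.integrable j k)

lemma loopIntegral_apply (F : ℂ → Matrix (Fin N) (Fin N) ℂ) (j k : Fin N) :
    loopIntegral γ F j k = (2 * (Real.pi : ℂ) * Complex.I)⁻¹ *
      ∫ t in (0 : ℝ)..1, F (γ.extend t) j k * deriv γ.extend t := by
  simp only [loopIntegral, Matrix.of_apply, curveIntegral_oneForm]

lemma IsLoopIntegrable.add (hF : IsLoopIntegrable γ F) (hG : IsLoopIntegrable γ G) :
    IsLoopIntegrable γ (fun z => F z + G z) := by
  intro j k
  simpa only [Matrix.add_apply, add_mul] using (hF j k).add (hG j k)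

lemma loopIntegral_add (hF : IsLoopIntegrable γ F) (hG : IsLoopIntegrable γ G) :
    loopIntegral γ (fun z => F z + G z) = loopIntegral γ F + loopIntegral γ G := by
  ext j k
  simp only [Matrix.add_apply, loopIntegral_apply, add_mul]
  rw [intervalIntegral.integral_add (hF j k) (hG j k), mul_add]

lemma IsLoopIntegrable.const_mul (hF : IsLoopIntegrable γ F) (A : Matrix (Fin N) (Fin N) ℂ) :
    IsLoopIntegrable γ (fun z => A * F z) := by
  intro j k
  simp only [Matrix.mul_apply, Finset.sum_mul, mul_assoc]
  have := IntervalIntegrable.sum Finset.univ (μ := volume) (a := 0) (b := 1)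
    (f := fun i t => A j i * (F (γ.extend t) i k * deriv γ.extend t))
    fun i _ => (hF i k).const_mul _
  simpa only [Finset.sum_fn] using this

lemma loopIntegral_const_mul (hF : IsLoopIntegrable γ F) (A : Matrix (Fin N) (Fin N) ℂ) :
    loopIntegral γ (fun z => A * F z) = A * loopIntegral γ F := by
  ext j k
  simp only [Matrix.mul_apply, loopIntegral_apply, Finset.sum_mul, mul_assoc]
  rw [intervalIntegral.integral_finsetSum fun i _ => (hF i k).const_mul _, Finset.mul_sum]
  refine Finset.sum_congr rfl fun i _ => ?_
  rw [intervalIntegral.integral_const_mul]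
  ring

lemma loopIntegral_mul_const (hF : IsLoopIntegrable γ F) (A : Matrix (Fin N) (Fin N) ℂ) :
    loopIntegral γ (fun z => F z * A) = loopIntegral γ F * A := by
  ext j k
  simp only [Matrix.mul_apply, loopIntegral_apply, Finset.sum_mul, mul_right_comm _ (A _ _)]
  rw [intervalIntegral.integral_finsetSum fun i _ => (hF j i).mul_const _, Finset.mul_sum]
  refine Finset.sum_congr rfl fun i _ => ?_
  rw [intervalIntegral.integral_mul_const]
  ring

lemma IsLoopIntegrable.pow_smul (hF : IsLoopIntegrable γ F) (n : ℕ) :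
    IsLoopIntegrable γ (fun z => z ^ n • F z) := by
  intro j k
  simp only [Matrix.smul_apply, smul_eq_mul, mul_assoc]
  exact (hF j k).continuousOn_mul (γ.continuous_extend.pow n).continuousOn

lemma loopIntegral_congr (hγ : IsSimpleLoop γ) (h : ∀ z ∈ arc γ, F z = G z) :
    loopIntegral γ F = loopIntegral γ G := by
  ext j k
  rw [loopIntegral_apply, loopIntegral_apply]
  congr 1
  apply intervalIntegral.integral_congr_ae_restrict
  rw [uIoc_of_le zero_le_one, ← restrict_Ioo_eq_restrict_Ioc]
  filter_upwards [ae_restrict_mem measurableSet_Ioo] with x hx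
  rw [h _ (hγ.extend_mem_arc hx)]

/-- This identifies analytic orthogonality with the algebraic pairing. Integrability is proved in
the same induction because additivity of the integral requires it. -/
lemma loopIntegral_eval_mul (hW : IsLoopIntegrable γ W) (k : ℕ)
    (P : Polynomial (Matrix (Fin N) (Fin N) ℂ)) :
    IsLoopIntegrable γ (fun z => z ^ k • (P.eval (Matrix.scalar (Fin N) z) * W z)) ∧
    loopIntegral γ (fun z => z ^ k • (P.eval (Matrix.scalar (Fin N) z) * W z)) =
      pairing (moment γ W) k P := by
  induction P using Polynomial.induction_on' with
  | add p q hp hq =>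
    simp only [Polynomial.eval_add, add_mul, smul_add, map_add]
    exact ⟨hp.1.add hq.1, by rw [loopIntegral_add hp.1 hq.1, hp.2, hq.2]⟩
  | monomial i a =>
    have h (z : ℂ) : z ^ k • ((Polynomial.monomial i a).eval (Matrix.scalar (Fin N) z) * W z) =
        a * (z ^ (i + k) • W z) := by
      rw [Polynomial.eval_monomial, ← map_pow, Matrix.scalar_apply, ← Matrix.smul_one_eq_diagonal,
        Matrix.mul_smul, Matrix.mul_one, Matrix.smul_mul, smul_smul, Matrix.mul_smul, pow_add,
        mul_comm]
    simp only [h, pairing_monomial]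
    exact ⟨(hW.pow_smul _).const_mul a, loopIntegral_const_mul (hW.pow_smul _) a⟩

/-- The Pearson equation, integrated by parts. -/
lemma momentRecursion_of_pearson (hγ : IsSimpleLoop γ) (hW : IsBesselWeight γ W)
    {h₀ h₁ h₂ : Matrix (Fin N) (Fin N) ℂ} (hP : SatisfiesPearson γ W h₀ h₁ h₂) :
    MomentRecursion (moment γ W) h₀ h₁ h₂ := by
  intro k
  have hi := hW.isLoopIntegrable
  have hA (n : ℕ) (A : Matrix (Fin N) (Fin N) ℂ) := (hi.pow_smul n).const_mul A
  have hD := (((hA k h₀).add (hA (k + 1) h₁)).add (hA (k + 2) h₂)).add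
    (hA (k + 1) ((k : Matrix (Fin N) (Fin N) ℂ) + 2))
  have hsum : h₀ * moment γ W k + h₁ * moment γ W (k + 1) + h₂ * moment γ W (k + 2)
      + ((k : Matrix (Fin N) (Fin N) ℂ) + 2) * moment γ W (k + 1) =
      loopIntegral γ (fun z => h₀ * (z ^ k • W z) + h₁ * (z ^ (k + 1) • W z)
        + h₂ * (z ^ (k + 2) • W z)
        + ((k : Matrix (Fin N) (Fin N) ℂ) + 2) * (z ^ (k + 1) • W z)) := by
    rw [loopIntegral_add (((hA k h₀).add (hA (k + 1) h₁)).add (hA (k + 2) h₂)) (hA _ _),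
      loopIntegral_add ((hA k h₀).add (hA (k + 1) h₁)) (hA _ _),
      loopIntegral_add (hA k h₀) (hA _ _)]
    simp only [moment, loopIntegral_const_mul (hi.pow_smul _)]
  rw [hsum]
  ext j l
  -- The integrand of the recursion, rearranged as the product-rule derivative of `z ^ (k + 2) W`
  -- with `z² W'` replaced through the Pearson equation.
  have hent (z : ℂ) : (h₀ * (z ^ k • W z) + h₁ * (z ^ (k + 1) • W z) + h₂ * (z ^ (k + 2) • W z)
      + ((k : Matrix (Fin N) (Fin N) ℂ) + 2) * (z ^ (k + 1) • W z)) j l =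
      ((k : ℂ) + 2) * z ^ (k + 1) * W z j l
        + z ^ k * ((h₀ + z • h₁ + z ^ 2 • h₂) * W z) j l := by
    have h1 : h₀ * (z ^ k • W z) + h₁ * (z ^ (k + 1) • W z) + h₂ * (z ^ (k + 2) • W z)
      + ((k : Matrix (Fin N) (Fin N) ℂ) + 2) * (z ^ (k + 1) • W z) =
      (((k : ℂ) + 2) * z ^ (k + 1)) • W z + z ^ k • ((h₀ + z • h₁ + z ^ 2 • h₂) * W z) := by
      have h2 : (k : Matrix (Fin N) (Fin N) ℂ) + 2 = ((k : ℂ) + 2) • 1 := by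
        rw [← Algebra.algebraMap_eq_smul_one, map_add, map_natCast, map_ofNat]
      rw [h2]
      simp only [add_mul, smul_add, Matrix.smul_mul, Matrix.mul_smul, one_mul]
      module
    rw [h1]
    rfl
  obtain ⟨L, hL, hexp, -⟩ := hW.entries
  obtain ⟨s, hs, hd⟩ := hγ.exists_hasDerivAt
  have hmaps : MapsTo γ.extend (Ioo 0 1) (arc γ) := fun t ht => hγ.extend_mem_arc ht
  have hWc : ContinuousOn (fun z => W z j l) (arc γ) := fun z hz => by
    obtain ⟨W', hW', -⟩ := hP z hz
    exact (hW' j l).continuousWithinAt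
  have hcont := γ.continuous_extend
  have hGc : ContinuousOn (fun t => γ.extend t ^ (k + 2) * W (γ.extend t) j l) (Ioo 0 1) :=
    (hcont.pow _).continuousOn.mul (hWc.comp hcont.continuousOn hmaps)
  have hGd : ∀ t ∈ Ioo (0 : ℝ) 1 \ s,
      HasDerivAt (fun t => γ.extend t ^ (k + 2) * W (γ.extend t) j l)
        ((((k : ℂ) + 2) * γ.extend t ^ (k + 1) * W (γ.extend t) j l
          + γ.extend t ^ k * ((h₀ + γ.extend t • h₁ + γ.extend t ^ 2 • h₂) * W (γ.extend t)) j l)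
            * deriv γ.extend t) t := by
    intro t ht
    obtain ⟨W', hW', heq⟩ := hP _ (hmaps ht.1)
    have hg := hd t ht
    have h1 : HasDerivAt (fun t => W (γ.extend t) j l) (W' j l * deriv γ.extend t) t := by
      rw [← hasDerivWithinAt_univ]
      have h2 := (hW' j l).scomp t (hg.hasDerivWithinAt (s := Ioo 0 1)) hmaps
      rw [smul_eq_mul, mul_comm] at h2
      exact (h2.hasDerivAt (isOpen_Ioo.mem_nhds ht.1)).hasDerivWithinAt
    refine ((hg.fun_pow (k + 2)).mul h1).congr_deriv ?_
    rw [← heq]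
    simp only [Matrix.smul_apply, smul_eq_mul,
      show k + 2 - 1 = k + 1 from rfl]
    push_cast
    ring
  have hi' := hD j l
  simp only [hent] at hi'
  obtain ⟨l₀, l₁, hl₀, hl₁, hint⟩ :=
    exists_tendsto_of_hasDerivAt_off_countable zero_lt_one hs hGc hGd hi'
  rw [loopIntegral_apply]
  simp only [hent]
  rw [hint, eq_zero_of_tendsto_zero hγ hL hexp (hi j l) hl₀,
    eq_zero_of_tendsto_one hγ hL hexp (hi j l) hl₁, sub_self, mul_zero, Matrix.zero_apply]

end LoopIntegral

end MatrixBessel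

namespace MatrixBessel

open Set Filter Topology MeasureTheory

/-! ### Solving the Pearson equation when its coefficients commute. -/

section CommutingPearson

open scoped Matrix.Norms.Operator
open NormedSpace (exp)

variable {N : ℕ} {γ : Path (0 : ℂ) 0} {W : ℂ → Matrix (Fin N) (Fin N) ℂ}
  {h₀ h₁ h₂ : Matrix (Fin N) (Fin N) ℂ}

lemma hasDerivAt_exp_smul {c : ℝ → ℂ} {c' : ℂ} {t : ℝ} (hc : HasDerivAt c c' t)
    (A : Matrix (Fin N) (Fin N) ℂ) :
    HasDerivAt (fun t => exp (c t • A)) (c' • (exp (c t • A) * A)) t :=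
  (hasDerivAt_exp_smul_const A (c t)).scomp t hc

lemma hasDerivAt_matrix {F : ℝ → Matrix (Fin N) (Fin N) ℂ} {F' : Matrix (Fin N) (Fin N) ℂ} {t : ℝ}
    (h : ∀ j k, HasDerivAt (fun t => F t j k) (F' j k) t) : HasDerivAt F F' t := by
  have h1 (A : Matrix (Fin N) (Fin N) ℂ) : A = ∑ j, ∑ k, A j k • Matrix.single j k (1 : ℂ) := by
    conv_lhs => rw [Matrix.matrix_eq_sum_single A]
    simp
  rw [h1 F', show F = fun t => ∑ j, ∑ k, F t j k • Matrix.single j k (1 : ℂ) from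
    funext fun t => h1 (F t)]
  exact HasDerivAt.fun_sum fun j _ => HasDerivAt.fun_sum fun k _ => (h j k).smul_const _

lemma commute_exp_smul {A B : Matrix (Fin N) (Fin N) ℂ} (h : Commute B A) (c : ℂ) :
    Commute B (exp (c • A)) :=
  (h.smul_right c).exp_right

/-- The Pearson equation with commuting coefficients is solved by a product of exponentials. -/
lemma exists_integrating_factor (hγ : IsSimpleLoop γ) (hW : IsBesselWeight γ W)
    (hP : SatisfiesPearson γ W h₀ h₁ h₂) (h01 : Commute h₀ h₁) (h02 : Commute h₀ h₂)
    (h12 : Commute h₁ h₂) :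
    ∃ (E : ℂ → Matrix (Fin N) (Fin N) ℂ) (K : Matrix (Fin N) (Fin N) ℂ),
      (∀ z ∈ arc γ, E z * W z = K) ∧ (∀ z, IsUnit (E z)) ∧
      ∀ B, Commute B h₀ → Commute B h₁ → Commute B h₂ → ∀ z, Commute B (E z) := by
  obtain ⟨L, hL, hexp, -⟩ := hW.entries
  obtain ⟨s, hs, hd⟩ := hγ.exists_hasDerivAt
  have hmaps : MapsTo γ.extend (Ioo 0 1) (arc γ) := fun t ht => hγ.extend_mem_arc ht
  have hcont := γ.continuous_extend
  -- The inverse of the fundamental solution `exp(-h₀ / z) z ^ h₁ exp(h₂ z)`, so that `E W` is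
  -- locally constant.
  let E : ℂ → Matrix (Fin N) (Fin N) ℂ := fun z =>
    exp (z⁻¹ • h₀) * exp ((-L z) • h₁) * exp ((-z) • h₂)
  have hLc : ContinuousOn (fun t => L (γ.extend t)) (Ioo 0 1) :=
    hL.comp hcont.continuousOn hmaps
  have hWc : ContinuousOn (fun t => W (γ.extend t)) (Ioo 0 1) := by
    refine ContinuousOn.comp (t := arc γ) ?_ hcont.continuousOn hmaps
    refine continuousOn_pi.2 fun j => continuousOn_pi.2 fun k => fun z hz => ?_
    obtain ⟨W', hW', -⟩ := hP z hz
    exact (hW' j k).continuousWithinAt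
  have hGc : ContinuousOn (fun t => E (γ.extend t) * W (γ.extend t)) (Ioo 0 1) := by
    have hexpc : Continuous (exp : Matrix (Fin N) (Fin N) ℂ → _) := NormedSpace.exp_continuous
    refine ContinuousOn.mul (ContinuousOn.mul (ContinuousOn.mul ?_ ?_) ?_) hWc
    · have hinv : ContinuousOn (fun t => (γ.extend t)⁻¹) (Ioo 0 1) :=
        hcont.continuousOn.inv₀ fun t ht => (hmaps ht).2
      exact hexpc.comp_continuousOn (hinv.smul continuousOn_const)
    · exact hexpc.comp_continuousOn (hLc.neg.smul continuousOn_const)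
    · exact hexpc.comp_continuousOn (hcont.neg.continuousOn.smul continuousOn_const)
  have hGd : ∀ t ∈ Ioo (0 : ℝ) 1 \ s,
      HasDerivAt (fun t => E (γ.extend t) * W (γ.extend t)) 0 t := by
    intro t ht
    obtain ⟨W', hW', heq⟩ := hP _ (hmaps ht.1)
    have hz : γ.extend t ≠ 0 := (hmaps ht.1).2
    have hg := hd t ht
    have hm : HasDerivAt (fun t => L (γ.extend t)) (deriv γ.extend t / γ.extend t) t := by
      refine hasDerivAt_of_exp_eq hg (hLc.continuousAt (isOpen_Ioo.mem_nhds ht.1)) ?_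
      filter_upwards [isOpen_Ioo.mem_nhds ht.1] with x hx using hexp _ (hmaps hx)
    have hw : HasDerivAt (fun t => W (γ.extend t)) (deriv γ.extend t • W') t := by
      refine hasDerivAt_matrix fun j k => ?_
      have h2 := (hW' j k).scomp t (hg.hasDerivWithinAt (s := Ioo 0 1)) hmaps
      exact h2.hasDerivAt (isOpen_Ioo.mem_nhds ht.1)
    have e0 := hasDerivAt_exp_smul (hg.fun_inv hz) h₀
    have e1 := hasDerivAt_exp_smul hm.fun_neg h₁
    have e2 := hasDerivAt_exp_smul hg.fun_neg h₂
    refine (((e0.fun_mul e1).fun_mul e2).fun_mul hw).congr_deriv ?_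
    have hW2 : W' = ((γ.extend t ^ 2)⁻¹ • h₀ + (γ.extend t)⁻¹ • h₁ + h₂) * W (γ.extend t) := by
      rw [← inv_smul_smul₀ (pow_ne_zero 2 hz) W', heq, ← Matrix.smul_mul, smul_add, smul_add,
        smul_smul, inv_smul_smul₀ (pow_ne_zero 2 hz)]
      congr 4
      field_simp
    rw [hW2]
    have c1 := commute_exp_smul h01 (-L (γ.extend t))
    have c2 := commute_exp_smul h02 (-γ.extend t)
    have c3 := commute_exp_smul h12 (-γ.extend t)
    generalize exp ((γ.extend t)⁻¹ • h₀) = E0 at *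
    generalize exp ((-L (γ.extend t)) • h₁) = E1 at *
    generalize exp ((-γ.extend t) • h₂) = E2 at *
    -- Commutativity of the `h`'s brings every differentiated factor next to `W`, where it cancels
    -- against the Pearson term.
    have k1 : E0 * h₀ * E1 * E2 = E0 * E1 * E2 * h₀ := by
      rw [mul_assoc E0, c1.eq, ← mul_assoc, mul_assoc _ h₀, c2.eq, ← mul_assoc]
    have k2 : E0 * E1 * h₁ * E2 = E0 * E1 * E2 * h₁ := by
      rw [mul_assoc _ h₁, c3.eq, ← mul_assoc]
    simp only [Matrix.smul_mul, Matrix.mul_smul, add_mul, mul_add, k1, k2, ← mul_assoc]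
    match_scalars <;> field_simp <;> ring
  refine ⟨E, E (γ.extend (1 / 2)) * W (γ.extend (1 / 2)), ?_, ?_, ?_⟩
  · rintro z ⟨⟨t, rfl⟩, hz⟩
    have ht : (t : ℝ) ∈ Ioo (0 : ℝ) 1 := by
      refine ⟨lt_of_le_of_ne t.2.1 ?_, lt_of_le_of_ne t.2.2 ?_⟩
      · intro h
        exact hz (by rw [mem_singleton_iff, show t = 0 from Subtype.ext h.symm, γ.source])
      · intro h
        exact hz (by rw [mem_singleton_iff, show t = 1 from Subtype.ext h, γ.target])
    have hsub : uIcc (1 / 2) (t : ℝ) ⊆ Ioo 0 1 :=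
      OrdConnected.uIcc_subset ordConnected_Ioo ⟨by norm_num, by norm_num⟩ ht
    have h1 := integral_eq_of_hasDerivAt_off_countable _ (fun _ => 0) hs (hGc.mono hsub)
      (fun x hx => hGd x ⟨hsub (Ioo_subset_Icc_self hx.1), hx.2⟩) (by simp)
    rw [intervalIntegral.integral_zero, eq_comm, sub_eq_zero, γ.extend_apply t.2] at h1
    exact h1
  · intro z
    exact ((Matrix.isUnit_exp _).mul (Matrix.isUnit_exp _)).mul (Matrix.isUnit_exp _)
  · intro B b0 b1 b2 z
    exact ((commute_exp_smul b0 _).mul_right (commute_exp_smul b1 _)).mul_right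
      (commute_exp_smul b2 _)

/-- On the arc `W Ki` is the inverse of `E`, so it commutes with everything that commutes with the
`h`'s, and integration preserves this. The factor `K` itself is an arbitrary constant and need not
commute with them. -/
lemma exists_commute_moment (hγ : IsSimpleLoop γ) (hW : IsBesselWeight γ W)
    (hP : SatisfiesPearson γ W h₀ h₁ h₂) (h01 : Commute h₀ h₁) (h02 : Commute h₀ h₂)
    (h12 : Commute h₁ h₂) (hM : IsUnit (moment γ W 0)) :
    ∃ K Ki : Matrix (Fin N) (Fin N) ℂ, K * Ki = 1 ∧ Ki * K = 1 ∧
      ∀ B, Commute B h₀ → Commute B h₁ → Commute B h₂ → ∀ n, Commute B (moment γ W n * Ki) := by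
  obtain ⟨E, K, hEK, hE, hcomm⟩ := exists_integrating_factor hγ hW hP h01 h02 h12
  have hi := hW.isLoopIntegrable
  -- If `K v = 0` then `W v = 0` on the whole arc, so the zeroth moment kills `v`. Repeating `v` in
  -- every column keeps the matrices square.
  have hK : IsUnit K := by
    by_contra hK
    rw [Matrix.isUnit_iff_isUnit_det, isUnit_iff_ne_zero, not_not,
      ← Matrix.exists_mulVec_eq_zero_iff] at hK
    obtain ⟨v, hv, hKv⟩ := hK
    let V : Matrix (Fin N) (Fin N) ℂ := Matrix.of fun i _ => v i
    have hKV : K * V = 0 := by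
      ext i j
      exact congrFun hKv i
    have h1 : moment γ W 0 * V = 0 := by
      rw [moment, ← loopIntegral_mul_const (hi.pow_smul 0),
        loopIntegral_congr (G := fun _ => 0) hγ]
      · ext j k; simp [loopIntegral_apply]
      · intro z hz
        rw [pow_zero, one_smul, ← (hE z).mul_right_eq_zero, ← mul_assoc, hEK z hz, hKV]
    rw [hM.mul_right_eq_zero] at h1
    apply hv
    funext i
    exact congrFun (congrFun h1 i) i
  obtain ⟨Ki, hKi, hKi'⟩ := isUnit_iff_exists.1 hK
  refine ⟨K, Ki, hKi, hKi', fun B b0 b1 b2 n => ?_⟩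
  have hi2 : IsLoopIntegrable γ (fun z => z ^ n • W z) := hi.pow_smul n
  have hi3 : IsLoopIntegrable γ (fun z => B * (z ^ n • W z)) := hi2.const_mul B
  rw [commute_iff_eq, moment, ← mul_assoc, ← loopIntegral_const_mul hi2,
    ← loopIntegral_mul_const hi3, mul_assoc, ← loopIntegral_mul_const hi2]
  refine loopIntegral_congr hγ fun z hz => ?_
  have h1 : E z * (W z * Ki) = 1 := by rw [← mul_assoc, hEK z hz, hKi]
  have h2 : W z * Ki * E z = 1 := mul_eq_one_comm.1 h1
  have h3 : B * (W z * Ki) = W z * Ki * B := by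
    calc B * (W z * Ki) = W z * Ki * E z * B * (W z * Ki) := by rw [h2, one_mul]
      _ = W z * Ki * (E z * B) * (W z * Ki) := by rw [mul_assoc _ (E z)]
      _ = W z * Ki * B * (E z * (W z * Ki)) := by
        rw [← (hcomm B b0 b1 b2 z).eq]; simp only [mul_assoc]
      _ = W z * Ki * B := by rw [h1, mul_one]
  simp only [Matrix.smul_mul, Matrix.mul_smul]
  rw [mul_assoc, h3, mul_assoc]

end CommutingPearson

end MatrixBessel

namespace MatrixBessel

open Set

/-! ### Assembly: the commuting coefficients and discrete Painlevé IV. -/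

section Assembly

variable {N : ℕ} {γ : Path (0 : ℂ) 0} {W : ℂ → Matrix (Fin N) (Fin N) ℂ}
  {P : ℕ → Polynomial (Matrix (Fin N) (Fin N) ℂ)} {C ξ η : ℕ → Matrix (Fin N) (Fin N) ℂ}
  {h₀ h₁ h₂ : Matrix (Fin N) (Fin N) ℂ}

lemma isRecurrence_iff : IsRecurrence P ξ η ↔ η 0 = 0 ∧ ∀ n, Polynomial.X * P n =
    P (n + 1) + Polynomial.C (ξ n) * P n + Polynomial.C (η n) * P (n - 1) := by
  constructor
  · rintro ⟨h1, h2, h3⟩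
    refine ⟨h1, fun n => ?_⟩
    cases n with
    | zero => rw [h2, h1]; simp
    | succ n => exact h3 n
  · rintro ⟨h1, h2⟩
    refine ⟨h1, ?_, fun n => h2 (n + 1)⟩
    rw [h2, h1]
    simp

lemma IsMonicLeftOrthogonal.isOrthogonalFamily (hW : IsBesselWeight γ W)
    (hP : IsMonicLeftOrthogonal γ W P C) :
    IsOrthogonalFamily (moment γ W) P C (fun n => (C n)⁻¹) where
  natDegree_le := hP.natDegree_le
  coeff_self := hP.coeff_self
  mul_inv n := Matrix.mul_nonsing_inv _ ((Matrix.isUnit_iff_isUnit_det _).1 (hP.isUnit n))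
  inv_mul n := Matrix.nonsing_inv_mul _ ((Matrix.isUnit_iff_isUnit_det _).1 (hP.isUnit n))
  orthogonal n k hk := by
    rw [← (loopIntegral_eval_mul hW.isLoopIntegrable k (P n)).2, hP.orthogonal n k hk]

/-- Since `P 0 = 1`, the zeroth moment is `(C 0)⁻¹`. -/
lemma IsMonicLeftOrthogonal.isUnit_moment (hW : IsBesselWeight γ W)
    (hP : IsMonicLeftOrthogonal γ W P C) : IsUnit (moment γ W 0) := by
  have h := hP.isOrthogonalFamily hW
  have h1 := h.pairing_self 0
  rw [Polynomial.eq_C_of_natDegree_le_zero (h.natDegree_le 0), h.coeff_self,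
    ← Polynomial.monomial_zero_left, pairing_monomial, one_mul] at h1
  rw [h1]
  exact IsUnit.of_mul_eq_one _ (h.inv_mul 0)

/-- The set of the coefficients is commutative if `h₀, h₁, h₂` commute. -/
lemma commute_of_mem_coeffSet (hγ : IsSimpleLoop γ) (hW : IsBesselWeight γ W)
    (hPearson : SatisfiesPearson γ W h₀ h₁ h₂) (hP : IsMonicLeftOrthogonal γ W P C)
    (hr : IsRecurrence P ξ η) (h01 : Commute h₀ h₁) (h02 : Commute h₀ h₂) (h12 : Commute h₁ h₂) :
    ∀ A ∈ coeffSet h₀ h₁ h₂ ξ η, ∀ B ∈ coeffSet h₀ h₁ h₂ ξ η, Commute A B := by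
  have h := hP.isOrthogonalFamily hW
  obtain ⟨hη, hrec⟩ := isRecurrence_iff.1 hr
  obtain ⟨K, Ki, hK, hK', hM⟩ :=
    exists_commute_moment hγ hW hPearson h01 h02 h12 (hP.isUnit_moment hW)
  have hM' (k : ℕ) : moment γ W k = moment γ W k * Ki * K := by rw [mul_assoc, hK', mul_one]
  have key (B : Matrix (Fin N) (Fin N) ℂ)
      (hB : ∀ n, Commute B (moment γ W n * Ki)) (n : ℕ) : Commute B (ξ n) ∧ Commute B (η n) :=
    h.commute_recurrence hη hrec (h.commute_polynomial hK hB hM') n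
  -- Two passes: `key` for the `h`'s shows that each coefficient commutes with them; each
  -- coefficient is then itself admissible as `B` in `key`.
  have hh : ∀ A ∈ coeffSet h₀ h₁ h₂ ξ η, Commute A h₀ ∧ Commute A h₁ ∧ Commute A h₂ := by
    have k0 := key h₀ (hM h₀ (Commute.refl _) h01 h02)
    have k1 := key h₁ (hM h₁ h01.symm (Commute.refl _) h12)
    have k2 := key h₂ (hM h₂ h02.symm h12.symm (Commute.refl _))
    rintro A (((rfl | rfl | rfl) | ⟨n, rfl⟩) | ⟨n, rfl⟩)
    · exact ⟨Commute.refl _, h01, h02⟩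
    · exact ⟨h01.symm, Commute.refl _, h12⟩
    · exact ⟨h02.symm, h12.symm, Commute.refl _⟩
    · exact ⟨(k0 n).1.symm, (k1 n).1.symm, (k2 n).1.symm⟩
    · exact ⟨(k0 n).2.symm, (k1 n).2.symm, (k2 n).2.symm⟩
  intro A hA B hB
  obtain ⟨a0, a1, a2⟩ := hh A hA
  have kA := key A (hM A a0 a1 a2)
  rcases hB with ((rfl | rfl | rfl) | ⟨n, rfl⟩) | ⟨n, rfl⟩
  · exact a0
  · exact a1
  · exact a2
  · exact (kA n).1
  · exact (kA n).2

/-- The reduced system follows from the non-Abelian one, once everything commutes. -/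
lemma reduced_of_commute (hcomm : ∀ A ∈ coeffSet h₀ h₁ h₂ ξ η,
      ∀ B ∈ coeffSet h₀ h₁ h₂ ξ η, Commute A B)
    (hconj : ∀ n m, m ≤ n + 1 → conjSum C ξ n m = partialSum ξ m) {n : ℕ}
    (first : FirstEquation h₀ h₁ h₂ C ξ η n) (second : SecondEquation h₁ h₂ C ξ η n) :
    ((h₂ * ξ n + h₁ + (2 * (n : ℂ) + 1) • 1) * ξ n + h₀ + h₂ * (η (n + 1) + η n)
      + partialSum ξ n + partialSum ξ (n + 1) = 0) ∧
    ξ n ^ 2 + (h₂ * (ξ n + ξ (n + 1)) + h₁ + (2 * (n : ℂ) + 3) • 1) * η (n + 1)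
      - η n * (h₂ * (ξ n + ξ (n - 1)) + h₁ + (2 * (n : ℂ) - 1) • 1) = 0 := by
  have m1 : h₁ ∈ coeffSet h₀ h₁ h₂ ξ η := by simp [coeffSet]
  have m2 : h₂ ∈ coeffSet h₀ h₁ h₂ ξ η := by simp [coeffSet]
  have mξ (k : ℕ) : ξ k ∈ coeffSet h₀ h₁ h₂ ξ η := by simp [coeffSet]
  have mη (k : ℕ) : η k ∈ coeffSet h₀ h₁ h₂ ξ η := by simp [coeffSet]
  have hS (k : ℕ) (A : Matrix (Fin N) (Fin N) ℂ) (hA : A ∈ coeffSet h₀ h₁ h₂ ξ η) :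
      ⁅partialSum ξ k, A⁆ = 0 :=
    (Commute.sum_left _ _ _ fun i _ => hcomm _ (mξ i) _ hA).lie_eq
  have hF : ⁅(∑ i ∈ Finset.range n, ∑ j ∈ Finset.range i, ξ i * ξ j)
      - ∑ k ∈ Finset.range n, η k, h₂⁆ = 0 := by
    refine Commute.lie_eq (Commute.sub_left ?_ ?_)
    · exact Commute.sum_left _ _ _ fun i _ => Commute.sum_left _ _ _ fun j _ =>
        (hcomm _ (mξ i) _ m2).mul_left (hcomm _ (mξ j) _ m2)
    · exact Commute.sum_left _ _ _ fun i _ => hcomm _ (mη i) _ m2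
  have hT : ⁅ξ n, partialSum ξ n⁆ = 0 := by
    exact (Commute.sum_right _ _ _ fun i _ => hcomm _ (mξ n) _ (mξ i)).lie_eq
  unfold FirstEquation at first
  unfold SecondEquation at second
  rw [hconj _ _ le_rfl, hF, hS _ _ m2, hS _ _ m1] at first
  rw [hconj _ _ (Nat.le_succ n), hT, hS _ _ m2, hS _ _ m2] at second
  simp only [zero_mul, mul_zero, sub_zero, add_zero] at first second
  constructor
  · rw [← first]
    simp only [add_mul, Matrix.smul_mul, one_mul]
    abel
  · rw [← second]
    simp only [add_mul, mul_add, sub_eq_add_neg, neg_add]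
    abel

open scoped IsMulCommutative in
/-- The forms of the reduced system as a discrete Painlevé IV equation. -/
lemma discretePainleveIV_of_reduced (hcomm : ∀ A ∈ coeffSet h₀ h₁ h₂ ξ η,
      ∀ B ∈ coeffSet h₀ h₁ h₂ ξ η, Commute A B) (hη : η 0 = 0) (hηu : ∀ n, IsUnit (η (n + 1)))
    (hred : ∀ n : ℕ, ((h₂ * ξ n + h₁ + (2 * (n : ℂ) + 1) • 1) * ξ n + h₀
      + h₂ * (η (n + 1) + η n) + partialSum ξ n + partialSum ξ (n + 1) = 0) ∧
    ξ n ^ 2 + (h₂ * (ξ n + ξ (n + 1)) + h₁ + (2 * (n : ℂ) + 3) • 1) * η (n + 1)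
      - η n * (h₂ * (ξ n + ξ (n - 1)) + h₁ + (2 * (n : ℂ) - 1) • 1) = 0) (n : ℕ) :
    DiscretePainleveIV h₀ h₁ h₂ ξ η n := by
  -- The first integral is proved over commutative rings, so it is applied in the commutative
  -- subalgebra generated by the coefficients.
  let A := Algebra.adjoin ℂ (coeffSet h₀ h₁ h₂ ξ η)
  have : IsMulCommutative A := Algebra.isMulCommutative_adjoin ℂ hcomm
  have mem {B : Matrix (Fin N) (Fin N) ℂ} (hB : B ∈ coeffSet h₀ h₁ h₂ ξ η) : B ∈ A :=
    Algebra.subset_adjoin hB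
  have comm {B D : Matrix (Fin N) (Fin N) ℂ} (hB : B ∈ A) (hD : D ∈ A) : Commute B D :=
    congrArg Subtype.val (mul_comm (⟨B, hB⟩ : A) ⟨D, hD⟩)
  have m0 : h₀ ∈ A := mem (by simp [coeffSet])
  have m1 : h₁ ∈ A := mem (by simp [coeffSet])
  have m2 : h₂ ∈ A := mem (by simp [coeffSet])
  have mξ (k : ℕ) : ξ k ∈ A := mem (by simp [coeffSet])
  have mη (k : ℕ) : η k ∈ A := mem (by simp [coeffSet])
  have mμ (k : ℕ) : mu h₁ h₂ ξ k ∈ A :=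
    add_mem (add_mem (mul_mem m2 (mξ k)) m1) (A.smul_mem (one_mem A) _)
  have c2 : ((2 : A) : Matrix (Fin N) (Fin N) ℂ) = 2 := map_ofNat A.val 2
  have c3 : ((3 : A) : Matrix (Fin N) (Fin N) ℂ) = 3 := map_ofNat A.val 3
  have hsq : nu h₀ h₂ ξ η (n + 1) ^ 2 - nu h₀ h₂ ξ η 0 ^ 2 =
      η (n + 1) * mu h₁ h₂ ξ n * mu h₁ h₂ ξ (n + 1) := by
    have main := congrArg Subtype.val (sq_sub_sq_eq_of_system
      (a := (1 / 2 : ℂ) • (⟨h₀, m0⟩ : A)) (h₁ := ⟨h₁, m1⟩) (h₂ := ⟨h₂, m2⟩)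
      (ξ := fun k => ⟨ξ k, mξ k⟩) (η := fun k => ⟨η k, mη k⟩) (Subtype.ext hη) ?_ ?_ n)
    · simp only [nu, mu, partialSum, hη, mul_zero, add_zero, Finset.range_zero, Finset.sum_empty,
        Algebra.smul_def, map_add, map_mul, map_natCast, map_ofNat, map_one, mul_one]
      simpa [Algebra.smul_def, c2] using main
    · intro k
      apply Subtype.ext
      have h1 := (hred k).1
      simp only [partialSum, Algebra.smul_def, map_add, map_mul, map_natCast, map_ofNat, map_one,
        mul_one] at h1
      have h2 : (2⁻¹ : ℂ) • (2 * h₀) = h₀ := by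
        rw [two_mul, ← two_smul ℂ h₀, inv_smul_smul₀ two_ne_zero]
      simpa [c2, h2] using h1
    · intro k
      apply Subtype.ext
      have h1 := (hred k).2
      simp only [Algebra.smul_def, map_add, map_sub, map_mul, map_natCast, map_ofNat, map_one,
        mul_one] at h1
      simpa [c2, c3] using h1
  have hlin : ξ n * mu h₁ h₂ ξ n = -(nu h₀ h₂ ξ η n + nu h₀ h₂ ξ η (n + 1)) := by
    have h1 := (hred n).1
    rw [(comm (mξ n) (mμ n)).eq, ← sub_eq_zero, ← h1]
    simp only [nu, mu, mul_add, sub_neg_eq_add]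
    module
  refine ⟨(hred n).1, (hred n).2, hsq, hlin, fun hh hμ hμ' => ?_, fun hh hμ => ?_⟩
  -- By the first integral this difference of squares is `η_{n+1} μ_n μ_{n+1}`, and `η_{n+1}` is
  -- always invertible.
  · have hD : IsUnit (nu h₀ h₂ ξ η (n + 1) ^ 2 - nu h₀ h₂ ξ η 0 ^ 2) := by
      rw [hsq]
      exact ((hηu n).mul hμ).mul hμ'
    refine ⟨hD, ?_⟩
    have e1 : nu h₀ h₂ ξ η (n + 1) - (1 / 2 : ℂ) • h₀ - partialSum ξ (n + 1) =
        h₂ * η (n + 1) := by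
      rw [nu]
      abel
    have dh := (Matrix.isUnit_iff_isUnit_det _).1 hh
    have dμ := (Matrix.isUnit_iff_isUnit_det _).1 hμ
    have dμ' := (Matrix.isUnit_iff_isUnit_det _).1 hμ'
    have dD := (Matrix.isUnit_iff_isUnit_det _).1 hD
    rw [e1, Matrix.nonsing_inv_mul_cancel_left _ _ dh]
    have e2 : (mu h₁ h₂ ξ n)⁻¹ * (mu h₁ h₂ ξ (n + 1))⁻¹ *
        (nu h₀ h₂ ξ η (n + 1) ^ 2 - nu h₀ h₂ ξ η 0 ^ 2) = η (n + 1) := by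
      rw [hsq, (comm (mul_mem (mη _) (mμ n)) (mμ (n + 1))).eq, (comm (mη _) (mμ n)).eq, mul_assoc,
        Matrix.nonsing_inv_mul_cancel_left _ _ dμ', Matrix.nonsing_inv_mul_cancel_left _ _ dμ]
    rw [← e2, Matrix.mul_nonsing_inv_cancel_right _ _ dD]
  · have dh := (Matrix.isUnit_iff_isUnit_det _).1 hh
    have dμ := (Matrix.isUnit_iff_isUnit_det _).1 hμ
    have e1 : h₁ + (2 * (n : ℂ) + 1) • 1 - mu h₁ h₂ ξ n = -(h₂ * ξ n) := by
      rw [mu]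
      abel
    rw [Matrix.nonsing_inv_nonsing_inv _ dμ, e1, mul_neg, mul_assoc, ← mul_assoc _ h₂,
      (comm (mμ n) m2).eq, mul_assoc h₂, Matrix.nonsing_inv_mul_cancel_left _ _ dh,
      ← (comm (mξ n) (mμ n)).eq, hlin, neg_neg]

end Assembly

end MatrixBessel

theorem mainTheorem3 {N : ℕ} (γ : Path (0 : ℂ) 0) (hγ : MatrixBessel.IsSimpleLoop γ)
    (W : ℂ → Matrix (Fin N) (Fin N) ℂ) (hW : MatrixBessel.IsBesselWeight γ W)
    (hreg : MatrixBessel.IsRegular γ W)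
    (h₀ h₁ h₂ : Matrix (Fin N) (Fin N) ℂ)
    (hPearson : MatrixBessel.SatisfiesPearson γ W h₀ h₁ h₂)
    (P : ℕ → Polynomial (Matrix (Fin N) (Fin N) ℂ)) (C : ℕ → Matrix (Fin N) (Fin N) ℂ)
    (hP : MatrixBessel.IsMonicLeftOrthogonal γ W P C) :
    (∃! r : (ℕ → Matrix (Fin N) (Fin N) ℂ) × (ℕ → Matrix (Fin N) (Fin N) ℂ),
      MatrixBessel.IsRecurrence P r.1 r.2) ∧
    ∀ ξ η : ℕ → Matrix (Fin N) (Fin N) ℂ, MatrixBessel.IsRecurrence P ξ η →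
      (∀ n, η (n + 1) = (C (n + 1))⁻¹ * C n) ∧
      (∀ n, MatrixBessel.FirstEquation h₀ h₁ h₂ C ξ η n ∧
        MatrixBessel.SecondEquation h₁ h₂ C ξ η n) ∧
      (Commute h₀ h₁ → Commute h₀ h₂ → Commute h₁ h₂ →
        (∀ A ∈ MatrixBessel.coeffSet h₀ h₁ h₂ ξ η, ∀ B ∈ MatrixBessel.coeffSet h₀ h₁ h₂ ξ η,
          Commute A B) ∧
        ∀ n, MatrixBessel.DiscretePainleveIV h₀ h₁ h₂ ξ η n) := by
  open MatrixBessel in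
  have h := hP.isOrthogonalFamily hW
  have hM := momentRecursion_of_pearson hγ hW hPearson
  refine ⟨?_, fun ξ η hr => ?_⟩
  · obtain ⟨ξ, η, hr⟩ := h.exists_recurrence
    refine ⟨(ξ, η), isRecurrence_iff.2 hr, ?_⟩
    rintro ⟨ξ', η'⟩ hr'
    obtain ⟨hη', hrec'⟩ := isRecurrence_iff.1 hr'
    obtain ⟨e1, e2⟩ := h.eq_recurrence hη' hr.1 hrec' hr.2
    exact Prod.ext e1 e2
  · obtain ⟨hη, hrec⟩ := isRecurrence_iff.1 hr
    have hsys (n : ℕ) : FirstEquation h₀ h₁ h₂ C ξ η n ∧ SecondEquation h₁ h₂ C ξ η n := by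
      constructor
      · have := h.first_equation hM hη hrec n
        unfold FirstEquation partialSum conjSum
        rw [← this]
        simp only [Algebra.smul_def, map_add, map_mul, map_natCast, map_ofNat, map_one]
      · have := h.second_equation hM hη hrec n
        unfold SecondEquation partialSum conjSum
        rw [← this]
        simp only [Algebra.smul_def, map_add, map_sub, map_mul, map_natCast, map_ofNat, map_one,
          mul_one]
    refine ⟨h.eta_succ hrec, hsys, fun h01 h02 h12 => ?_⟩
    have hcomm := commute_of_mem_coeffSet hγ hW hPearson hP hr h01 h02 h12
    refine ⟨hcomm, discretePainleveIV_of_reduced hcomm hη (fun n => ?_) fun n =>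
      reduced_of_commute (C := C) hcomm (fun n m hm => ?_) (hsys n).1 (hsys n).2⟩
    · rw [h.eta_succ hrec]
      exact (IsUnit.of_mul_eq_one _ (h.inv_mul _)).mul (hP.isUnit n)
    · exact h.conj_sum_eq hrec (fun i j => hcomm _ (by simp [coeffSet]) _ (by simp [coeffSet])) hm
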